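/- **Setting.** Let $B\ge 1$, let $d_0,d_1,\dots,d_B\ge 1$ and $L_1,\dots,L_B\ge 2$ be fixed integers, and let $m\ge 1$. For weights $W_b^{(1)}\in\mathbb R^{m\times d_{b-1}}$, $W_b^{(\ell)}\in\mathbb R^{m\times m}$ ($1<\ell<L_b$), $W_b^{(L_b)}\in\mathbb R^{d_b\times m}$, let $$f_b(\mathbf W_b;z)=\tfrac{1}{\sqrt m}W_b^{(L_b)}\tfrac1{\sqrt m}W_b^{(L_b-1)}\cdots\tfrac{1}{\sqrt{d_{b-1}}}W_b^{(1)}z,\qquad z\in\mathbb R^{d_{b-1}},$$ be the wide linear network with weights $\mathbf W_b=(W_b^{(1)},\dots,W_b^{(L_b)})$. The linear network with $B-1$ bottleneck layers is the cascade $g(\mathcal W;x)=f_B(\mathbf W_B;f_{B-1}(\mathbf W_{B-1};\cdots f_1(\mathbf W_1;x)))\in\mathbb R^{d_B}$, where $\mathcal W=(\mathbf W_1,\dots,\mathbf W_B)$ and $x\in\mathbb R^{d_0}$. All entries of the initial weights $\mathcal W_0$ are independent $\mathcal N(0,1)$ variables. Let $\mathbb B(\mathcal W_0,R)$ be the set of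 $\mathcal W$ with $\|W_b^{(\ell)}-W_{b,0}^{(\ell)}\|_F\le R$ for all $b,\ell$, and let $$J(\mathcal W)=\sum_{j=0}^{B}\frac1{j!}\,\frac{d^j g(\mathcal W_0;x)}{d\mathcal W^j}\big[(\mathcal W-\mathcal W_0)^{\otimes j}\big]$$ be the $B$-jet of $g(\cdot;x)$ at $\mathcal W_0$. A map is called a polynomial of degree $n$ if it is smooth, its $n$-th derivative vanishes nowhere and its $(n+1)$-st derivative vanishes identically. Derivatives are measured in operator norm, with the Euclidean norm on the tuple of all weights. **Theorem (transition to $B$-th degree polynomials).** 1. There are $c,\kappa>0$ and $m_0$, depending only on $B,(d_b),(L_b)$, and for every $R>0$ a constant $C>0$, depending only on $B,(d_b),(L_b),R$, such that for all $m\ge m_0$ and every input $x\in\mathbb R^{d_0}$, with probability at least $1-e^{-cm}$ over $\mathcal W_0$, all of the following hold: - $\|g(\mathcal W;x)-J(\mathcal W)\|\le C\|x\|/\sqrt m$ for all $\mathcal W\in\mathbb B(\mathcal W_0,R)$; - $\big\|\frac{d^{B+1}g(\mathcal W;x)}{d\mathcal W^{B+1}}\big\|_{\rm op}\le C\|x\|/\sqrt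 m$ for all $\mathcal W\in\mathbb B(\mathcal W_0,R)$; - $\big\|\frac{d^{B}g(\mathcal W_0;x)}{d\mathcal W^{B}}\big\|_{\rm op}\ge\kappa\|x\|$; - if $x\ne0$, then $J$ is a polynomial of degree $B$, whatever the total depth $\sum_b L_b$ is. 2. For all $m$, $x$ and $\mathcal W_0$, the polynomial $J$ is multilinear in $\mathcal W$ in the sense that it is an affine function of each weight matrix $W_b^{(\ell)}$ when all the other weight matrices are held constant. 3. As $m\to\infty$, $g$ transitions to a $B$-th degree multilinear function of the $B$ blocks of weights: for all $R,\delta>0$ there are $C>0$ and $m_0$ such that for all $m\ge m_0$ and every $x$, with probability at least $1-\delta$ over $\mathcal W_0$ there is a function $q$ of $\mathcal W$ that is a polynomial of degree $B$ if $x\neq 0$, is affine in each block $\mathbf W_b$ (jointly in its $L_b$ matrices) when the other blocks are held constant, and satisfies $\|g(\mathcal W;x)-q(\mathcal W)\|\le C\|x\|/\sqrt m$ for all $\mathcal W\in\mathbb B(\mathcal W_0,R)$. -/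

import Mathlib

open MeasureTheory ProbabilityTheory Matrix
open scoped ContDiff

/-- Number of units of node layer `ℓ` of a wide network with `k + 2` weight layers: `din` inputs,
`dout` outputs, and `m` units in each hidden layer. -/
def layerWidth (m k din dout : ℕ) (ℓ : Fin (k + 3)) : ℕ :=
  if ℓ = 0 then din else if ℓ = Fin.last (k + 2) then dout else m

theorem layerWidth_zero (m k din dout : ℕ) : layerWidth m k din dout 0 = din := by
  simp [layerWidth]

theorem layerWidth_last (m k din dout : ℕ) :
    layerWidth m k din dout (Fin.last (k + 2)) = dout := by
  simp [layerWidth, Fin.ext_iff]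

/-- The values of the node layers of a wide linear network with input `z`: each weight matrix is
applied to the previous layer and divided by the square root of the number of its columns. -/
noncomputable def wnnNodes (m k din dout : ℕ)
    (W : ∀ ℓ : Fin (k + 2), Matrix (Fin (layerWidth m k din dout ℓ.succ))
      (Fin (layerWidth m k din dout ℓ.castSucc)) ℝ)
    (z : Fin din → ℝ) : ∀ ℓ : Fin (k + 3), Fin (layerWidth m k din dout ℓ) → ℝ :=
  Fin.induction (fun j => z (Fin.cast (layerWidth_zero m k din dout) j))
    (fun ℓ h => (1 / √(layerWidth m k din dout ℓ.castSucc : ℝ)) • (W ℓ *ᵥ h))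

/-- The wide linear network with `L = k + 2` weight layers,
`f(W; z) = m^(-1/2) W⁽ᴸ⁾ m^(-1/2) W⁽ᴸ⁻¹⁾ ⋯ din^(-1/2) W⁽¹⁾ z`. -/
noncomputable def wnn (m k din dout : ℕ)
    (W : ∀ ℓ : Fin (k + 2), Matrix (Fin (layerWidth m k din dout ℓ.succ))
      (Fin (layerWidth m k din dout ℓ.castSucc)) ℝ)
    (z : Fin din → ℝ) : Fin dout → ℝ :=
  fun i => wnnNodes m k din dout W z (Fin.last (k + 2))
    (Fin.cast (layerWidth_last m k din dout).symm i)

/-- A weight layer of the bottleneck network: a block `b` and a layer of that block.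
Block `b` has `k b + 2` weight layers. -/
abbrev LayerIdx {B : ℕ} (k : Fin B → ℕ) : Type := Σ b : Fin B, Fin (k b + 2)

/-- A scalar weight: a layer together with a row and a column of its matrix. Block `b` maps
`d b` inputs (`b` read as an element of `Fin (B + 1)`) to `d (b + 1)` outputs. -/
abbrev WeightIdx {B : ℕ} (d : Fin (B + 1) → ℕ) (k : Fin B → ℕ) (m : ℕ) : Type :=
  Σ p : LayerIdx k, Fin (layerWidth m (k p.1) (d p.1.castSucc) (d p.1.succ) p.2.succ) ×
    Fin (layerWidth m (k p.1) (d p.1.castSucc) (d p.1.succ) p.2.castSucc)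

/-- The tuple of all weights, flattened. The Euclidean norm is the Frobenius norm of the tuple. -/
abbrev Params {B : ℕ} (d : Fin (B + 1) → ℕ) (k : Fin B → ℕ) (m : ℕ) : Type :=
  EuclideanSpace ℝ (WeightIdx d k m)

/-- The weight matrix of a layer. -/
def weightMatrix {B : ℕ} {d : Fin (B + 1) → ℕ} {k : Fin B → ℕ} {m : ℕ} (W : Params d k m)
    (b : Fin B) (ℓ : Fin (k b + 2)) :
    Matrix (Fin (layerWidth m (k b) (d b.castSucc) (d b.succ) ℓ.succ))
      (Fin (layerWidth m (k b) (d b.castSucc) (d b.succ) ℓ.castSucc)) ℝ :=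
  Matrix.of fun i j => W ⟨⟨b, ℓ⟩, i, j⟩

/-- The values at the input and after each block of the cascade of wide linear networks. -/
noncomputable def bnnNodes {B : ℕ} {d : Fin (B + 1) → ℕ} {k : Fin B → ℕ} {m : ℕ}
    (W : Params d k m) (x : Fin (d 0) → ℝ) : ∀ b : Fin (B + 1), Fin (d b) → ℝ :=
  Fin.induction x
    (fun b z => wnn m (k b) (d b.castSucc) (d b.succ) (weightMatrix W b) z)

/-- The linear bottleneck network `g(W; x) = f_B(W_B; f_{B-1}(W_{B-1}; ⋯ f_1(W_1; x)))`. -/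
noncomputable def bnn {B : ℕ} {d : Fin (B + 1) → ℕ} {k : Fin B → ℕ} {m : ℕ}
    (x : EuclideanSpace ℝ (Fin (d 0))) (W : Params d k m) :
    EuclideanSpace ℝ (Fin (d (Fin.last B))) :=
  WithLp.toLp 2 (bnnNodes W x.ofLp (Fin.last B))

/-- Random initialization: all weights are independent standard normal variables. -/
noncomputable def initLaw {B : ℕ} (d : Fin (B + 1) → ℕ) (k : Fin B → ℕ) (m : ℕ) :
    Measure (Params d k m) :=
  (Measure.pi fun _ : WeightIdx d k m => gaussianReal 0 1).map (WithLp.toLp 2)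

/-- The ball around `W₀`: each weight matrix differs from that of `W₀` by at most `R` in
Frobenius norm. -/
def weightBall {B : ℕ} {d : Fin (B + 1) → ℕ} {k : Fin B → ℕ} {m : ℕ} (W₀ : Params d k m)
    (R : ℝ) : Set (Params d k m) :=
  {W | ∀ (b : Fin B) (ℓ : Fin (k b + 2)),
    √(∑ i, ∑ j, (weightMatrix W b ℓ i j - weightMatrix W₀ b ℓ i j) ^ 2) ≤ R}

/-- The `n`-jet of `f` at `w₀`, evaluated at the displacement `v`. -/
noncomputable def jet {E F : Type*} [NormedAddCommGroup E] [NormedSpace ℝ E]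
    [NormedAddCommGroup F] [NormedSpace ℝ F] (n : ℕ) (f : E → F) (w₀ v : E) : F :=
  ∑ j ∈ Finset.range (n + 1), (1 / (j.factorial : ℝ)) • iteratedFDeriv ℝ j f w₀ (fun _ => v)

/-- `f` is a polynomial of degree exactly `n`: it is smooth, its `n`-th derivative vanishes
nowhere, and its `(n + 1)`-st derivative vanishes identically. -/
def IsPolynomialOfDegree {E F : Type*} [NormedAddCommGroup E] [NormedSpace ℝ E]
    [NormedAddCommGroup F] [NormedSpace ℝ F] (n : ℕ) (f : E → F) : Prop :=
  ContDiff ℝ ∞ f ∧ ∀ w, 0 < ‖iteratedFDeriv ℝ n f w‖ ∧ ‖iteratedFDeriv ℝ (n + 1) f w‖ = 0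

/-- `f` is an affine function of the coordinates in `s` (jointly) when all other coordinates are
held constant. -/
def IsAffineInCoords {ι F : Type*} [AddCommGroup F] [Module ℝ F] (s : Set ι)
    (f : EuclideanSpace ℝ ι → F) : Prop :=
  ∀ U V : EuclideanSpace ℝ ι, (∀ i, i ∉ s → U i = V i) →
    ∀ t : ℝ, f ((1 - t) • U + t • V) = (1 - t) • f U + t • f V

/-! ### Jets -/

section Jet

variable {E E' F : Type*} [NormedAddCommGroup E] [NormedSpace ℝ E] [NormedAddCommGroup E']
  [NormedSpace ℝ E'] [NormedAddCommGroup F] [NormedSpace ℝ F]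

/-! The network is a multilinear map of its weight matrices, and everything comes from counting
powers of `√m`. Block `b` has `k b + 1` hidden layers. With `S = ∑ b, (k b + 1)` there are `S + B`
weight layers in all, and the normalizations give the multilinear map norm at most `‖x‖ m^(-S/2)`.
At initialization, and on the ball of radius `R` around it, every weight matrix has operator norm
`O(√m)`. A derivative of order `n` fills `n` slots with directions and leaves `S + B - n` slots of
size `O(√m)`, so it is `O(m^((B - n)/2))`. Order `B + 1` thus costs `1/√m` (`width_power_bound`),
and Taylor's theorem gives the jet approximation (`norm_bnn_sub_jet_le`).

The derivative of order `B` does not decay. In each block, the last matrix is perturbed by a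
rank-one matrix that sends the last hidden vector to a multiple of a fixed unit input of the next
block. Gaussian hidden layers stretch a given vector by at least `ε √m`, which offsets the
normalization, so the mixed derivative in these `B` directions has size at least `κ ‖x‖`
(`NodesGrow.le_norm_iteratedFDeriv`).

The `B`-jet may contain terms with several directions in the same block, so blockwise multilinearity
needs another function: the cascade of the first-order expansions of the blocks. On the ball a block
moves by `O(1)` with quadratic remainder `O(1/√m)`, and composition is Lipschitz on bounded sets
(`norm_bnn_sub_outerMap_linBlock_le`). This needs the initial block operators to be bounded. Their
output dimension is fixed, so the bound holds only with probability close to one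
(`exists_initLaw_outputsBounded`), not exponentially close as in `exists_initLaw_regular`.

The probabilistic inputs are a net argument for operator norms, an exponential moment for lower
tails, and resampling of one layer with the others frozen, which plays the role of conditioning. -/

theorem jet_comp_clm (n : ℕ) {f : E → F} (hf : ContDiff ℝ ∞ f) (L : E' →L[ℝ] E) (w v : E') :
    jet n (f ∘ L) w v = jet n f (L w) (L v) := by
  unfold jet
  refine Finset.sum_congr rfl fun j _ => ?_
  rw [L.iteratedFDeriv_comp_right hf w (i := j) (by exact_mod_cast le_top)]
  rfl

/-- **Taylor's theorem**: the error of the `n`-jet is controlled by the `(n + 1)`-st derivative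
on the segment. -/
theorem norm_sub_jet_le [CompleteSpace F] (n : ℕ) {f : E → F} (hf : ContDiff ℝ ∞ f) (w v : E)
    {C : ℝ} (hC : ∀ t ∈ Set.Icc (0 : ℝ) 1, ‖iteratedFDeriv ℝ (n + 1) f (w + t • v)‖ ≤ C) :
    ‖f (w + v) - jet n f w v‖ ≤ C * ‖v‖ ^ (n + 1) := by
  have hC0 : 0 ≤ C := (norm_nonneg _).trans (hC 0 (by simp))
  rw [map_add_eq_sum_add_integral_iteratedFDeriv (n := n)
    (fun t _ => hf.contDiffAt.of_le (by exact_mod_cast le_top))]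
  have h : jet n f w v =
      ∑ k ∈ Finset.range (n + 1), (k.factorial : ℝ)⁻¹ • iteratedFDeriv ℝ k f w (fun _ ↦ v) := by
    simp [jet]
  rw [h, add_sub_cancel_left, norm_smul]
  have hint : ‖∫ t in (0 : ℝ)..1,
      (1 - t) ^ n • iteratedFDeriv ℝ (n + 1) f (w + t • v) (fun _ ↦ v)‖
      ≤ (C * ‖v‖ ^ (n + 1)) * |1 - 0| := by
    refine intervalIntegral.norm_integral_le_of_norm_le_const fun t ht => ?_
    rw [Set.uIoc_of_le zero_le_one] at ht
    have ht' : t ∈ Set.Icc (0 : ℝ) 1 := ⟨ht.1.le, ht.2⟩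
    have h1 : ‖(1 - t) ^ n‖ ≤ 1 := by
      rw [norm_pow]
      refine pow_le_one₀ (norm_nonneg _) ?_
      rw [Real.norm_eq_abs, abs_le]; constructor <;> linarith [ht.1, ht.2]
    calc _ ≤ ‖(1 - t) ^ n‖ * ‖iteratedFDeriv ℝ (n + 1) f (w + t • v) (fun _ ↦ v)‖ :=
          norm_smul_le _ _
      _ ≤ 1 * (C * ‖v‖ ^ (n + 1)) := by
          gcongr
          refine ((iteratedFDeriv ℝ (n + 1) f (w + t • v)).le_opNorm _).trans ?_
          simp only [Finset.prod_const, Finset.card_univ, Fintype.card_fin]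
          gcongr
          exact hC t ht'
      _ = _ := one_mul _
  -- The weight `(1 - t) ^ n` and the factor `1 / n!` are both bounded by one; no sharp constant is
  -- needed.
  have hfac : ‖((n.factorial : ℝ))⁻¹‖ ≤ 1 := by
    rw [norm_inv, Real.norm_natCast]
    exact inv_le_one_of_one_le₀ (by exact_mod_cast n.factorial_pos)
  calc _ ≤ 1 * ((C * ‖v‖ ^ (n + 1)) * |1 - 0|) := by gcongr
    _ = _ := by norm_num

/-- The diagonal is linear, so this is a `j`-linear map along a linear map; the bound for its `n`-th
derivative carries the falling factorial of `j` of length `n`, which is zero for `n > j`. -/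
theorem iteratedFDeriv_diagonal_eq_zero {j n : ℕ} (hjn : j < n)
    (p : ContinuousMultilinearMap ℝ (fun _ : Fin j => E) F) (w : E) :
    iteratedFDeriv ℝ n (fun x => p fun _ => x) w = 0 := by
  let g : E →L[ℝ] (Fin j → E) := ContinuousLinearMap.pi fun _ => ContinuousLinearMap.id ℝ E
  change iteratedFDeriv ℝ n (p ∘ g) w = 0
  rw [g.iteratedFDeriv_comp_right p.contDiff w le_rfl]
  have h : iteratedFDeriv ℝ n p (g w) = 0 := by
    have := p.norm_iteratedFDeriv_le n (g w)
    rw [Nat.descFactorial_of_lt (by simpa using hjn)] at this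
    simpa using this
  rw [h]
  rfl

theorem contDiff_diagonal {j : ℕ} (p : ContinuousMultilinearMap ℝ (fun _ : Fin j => E) F)
    {n : WithTop ℕ∞} : ContDiff ℝ n (fun x => p fun _ => x) := by
  exact p.contDiff.comp (contDiff_pi.2 fun _ => contDiff_id)

theorem contDiff_jet_sub (n : ℕ) (f : E → F) (w₀ : E) :
    ContDiff ℝ ∞ (fun w => jet n f w₀ (w - w₀)) := by
  unfold jet
  refine ContDiff.sum fun j _ => ContDiff.const_smul _ ?_
  exact (contDiff_diagonal (iteratedFDeriv ℝ j f w₀)).comp (contDiff_id.sub contDiff_const)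

theorem iteratedFDeriv_jet_sub (N n : ℕ) (f : E → F) (w₀ w : E) :
    iteratedFDeriv ℝ N (fun w => jet n f w₀ (w - w₀)) w =
      ∑ j ∈ Finset.range (n + 1), (1 / (j.factorial : ℝ)) •
        iteratedFDeriv ℝ N (fun v => iteratedFDeriv ℝ j f w₀ fun _ => v) (w - w₀) := by
  rw [show (fun w => jet n f w₀ (w - w₀)) = fun w => (jet n f w₀) (w + -w₀) from
    by simp [sub_eq_add_neg], iteratedFDeriv_comp_add_right, ← sub_eq_add_neg]
  unfold jet
  rw [iteratedFDeriv_sum fun j _ => ContDiff.const_smul _ (contDiff_diagonal _),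
    Finset.sum_apply]
  refine Finset.sum_congr rfl fun j _ => ?_
  exact iteratedFDeriv_const_smul_apply' (contDiff_diagonal _).contDiffAt

/-- Terms of order below `n` die. The term of order `n` contributes a sum over all permutations of
the directions; by symmetry of the derivative this is `n!` equal terms, cancelling `1 / n!`. The
result does not depend on `w`, so nonvanishing at `w₀` gives nonvanishing everywhere. -/
theorem iteratedFDeriv_jet_sub_eq (n : ℕ) {f : E → F} (hf : ContDiff ℝ ω f) (w₀ w : E) :
    iteratedFDeriv ℝ n (fun w => jet n f w₀ (w - w₀)) w = iteratedFDeriv ℝ n f w₀ := by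
  rw [iteratedFDeriv_jet_sub, Finset.sum_range_succ, Finset.sum_eq_zero, zero_add]
  · ext v
    rw [_root_.smul_apply,
      ContinuousMultilinearMap.iteratedFDeriv_comp_diagonal]
    have h : ∀ σ : Equiv.Perm (Fin n), iteratedFDeriv ℝ n f w₀ (fun i => v (σ i)) =
        iteratedFDeriv ℝ n f w₀ v := fun σ => hf.contDiffAt.iteratedFDeriv_comp_perm v σ
    simp only [h, Finset.sum_const, Finset.card_univ, Fintype.card_perm, Fintype.card_fin]
    rw [← Nat.cast_smul_eq_nsmul ℝ, smul_smul, one_div_mul_cancel, one_smul]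
    exact_mod_cast n.factorial_ne_zero
  · intro j hj
    rw [iteratedFDeriv_diagonal_eq_zero (Finset.mem_range.1 hj), smul_zero]

theorem isPolynomialOfDegree_jet_sub (n : ℕ) {f : E → F} (hf : ContDiff ℝ ω f) (w₀ : E)
    (h : 0 < ‖iteratedFDeriv ℝ n f w₀‖) :
    IsPolynomialOfDegree n (fun w => jet n f w₀ (w - w₀)) := by
  refine ⟨contDiff_jet_sub n f w₀, fun w => ⟨?_, ?_⟩⟩
  · rwa [iteratedFDeriv_jet_sub_eq n hf]
  · rw [iteratedFDeriv_jet_sub, Finset.sum_eq_zero, norm_zero]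
    intro j hj
    rw [iteratedFDeriv_diagonal_eq_zero (Finset.mem_range.1 hj), smul_zero]

theorem jet_one (f : E → F) (w v : E) : jet 1 f w v = f w + fderiv ℝ f w v := by
  simp [jet, Finset.sum_range_succ]

end Jet

/-! ### Calculus of continuous multilinear maps -/

namespace ContinuousMultilinearMap

variable {ι : Type*} [Fintype ι] {E : ι → Type*} [∀ i, NormedAddCommGroup (E i)]
  [∀ i, NormedSpace ℝ (E i)] {F : Type*} [NormedAddCommGroup F] [NormedSpace ℝ F]
  {P : Type*} [NormedAddCommGroup P] [NormedSpace ℝ P]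

open scoped Classical in
-- Differentiating distributes the directions injectively among the slots, and the remaining slots
-- keep the base point. Affinity of jets and the structure of top-order derivatives are read off
-- from this formula.
theorem iteratedFDeriv_apply_eq_sum (f : ContinuousMultilinearMap ℝ E F) (n : ℕ) (x : ∀ i, E i)
    (v : Fin n → ∀ i, E i) :
    _root_.iteratedFDeriv ℝ n f x v = ∑ e : Fin n ↪ ι,
      f fun i => if h : i ∈ Set.range e then v (e.toEquivRange.symm ⟨i, h⟩) i else x i := by
  rw [f.iteratedFDeriv_eq]
  simp [ContinuousMultilinearMap.iteratedFDeriv, _root_.sum_apply]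

omit [Fintype ι] in
/-- A multilinear map is affine in each variable. -/
theorem map_lineMap_of_eq_off (f : ContinuousMultilinearMap ℝ E F) (p : ι) (u v : ∀ i, E i)
    (huv : ∀ i, i ≠ p → u i = v i) (t : ℝ) :
    f ((1 - t) • u + t • v) = (1 - t) • f u + t • f v := by
  classical
  have hu : u = Function.update v p (u p) := by
    ext i; by_cases h : i = p
    · subst h; simp
    · simp [h, huv i h]
  have hw : (1 - t) • u + t • v = Function.update v p ((1 - t) • u p + t • v p) := by
    ext i; by_cases h : i = p
    · subst h; simp
    · simp only [Pi.add_apply, Pi.smul_apply, Function.update_of_ne h, huv i h, ← add_smul]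
      simp
  rw [hw, f.map_update_add, f.map_update_smul, f.map_update_smul, ← hu, Function.update_eq_self]

theorem jet_lineMap_of_eq_off (f : ContinuousMultilinearMap ℝ E F) (n : ℕ) (x : ∀ i, E i) (p : ι)
    (u v : ∀ i, E i) (huv : ∀ i, i ≠ p → u i = v i) (t : ℝ) :
    jet n f x ((1 - t) • u + t • v) = (1 - t) • jet n f x u + t • jet n f x v := by
  classical
  simp only [jet, iteratedFDeriv_apply_eq_sum, Finset.smul_sum, ← Finset.sum_add_distrib]
  refine Finset.sum_congr rfl fun j _ => Finset.sum_congr rfl fun e _ => ?_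
  -- In each term a slot holds either the displacement or the base point, once. The tuples for `u`
  -- and `v` therefore still differ at most in slot `p`, and a base point is the affine combination
  -- of itself with itself.
  have := map_lineMap_of_eq_off f p (fun i => if i ∈ Set.range e then u i else x i)
    (fun i => if i ∈ Set.range e then v i else x i)
    (fun i hi => by simp only [huv i hi]) t
  rw [smul_comm (1 - t), smul_comm t, ← smul_add]
  congr 1
  simp only [dite_eq_ite]
  rw [← this]
  congr 1
  ext i
  simp only [Pi.add_apply, Pi.smul_apply]
  split_ifs
  · rfl
  · rw [← add_smul]; simp

/-- Bound for the derivatives of a multilinear map along a continuous linear map. -/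
theorem norm_iteratedFDeriv_comp_clm_le (f : ContinuousMultilinearMap ℝ E F)
    (L : P →L[ℝ] ∀ i, E i) (hL : ‖L‖ ≤ 1) (n : ℕ) (w : P) {K : ℝ} (hK : ‖L w‖ ≤ K) :
    ‖_root_.iteratedFDeriv ℝ n (f ∘ L) w‖ ≤
      (Fintype.card ι).descFactorial n * ‖f‖ * K ^ (Fintype.card ι - n) := by
  rw [L.iteratedFDeriv_comp_right f.contDiff w le_rfl]
  refine (norm_compContinuousLinearMap_le _ _).trans ?_
  have h : ∏ _i : Fin n, ‖L‖ ≤ 1 := by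
    simpa using pow_le_one₀ (norm_nonneg L) hL
  calc _ ≤ ‖_root_.iteratedFDeriv ℝ n f (L w)‖ * 1 := by gcongr
    _ ≤ (Fintype.card ι).descFactorial n * ‖f‖ * ‖L w‖ ^ (Fintype.card ι - n) := by
        rw [mul_one]; exact f.norm_iteratedFDeriv_le n _
    _ ≤ _ := by gcongr

/-- Taylor's theorem: on the segment the argument has norm at most `K + R`, and a derivative of
order `n + 1` leaves `card ι - (n + 1)` slots to be filled with it. -/
theorem norm_map_add_sub_jet_le [CompleteSpace F] (f : ContinuousMultilinearMap ℝ E F) (n : ℕ)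
    (x v : ∀ i, E i) {K R : ℝ} (hx : ‖x‖ ≤ K) (hv : ‖v‖ ≤ R) :
    ‖f (x + v) - jet n f x v‖ ≤ (Fintype.card ι).descFactorial (n + 1) * ‖f‖ *
      (K + R) ^ (Fintype.card ι - (n + 1)) * R ^ (n + 1) := by
  have hK : 0 ≤ K := (norm_nonneg _).trans hx
  have hR : 0 ≤ R := (norm_nonneg _).trans hv
  refine (norm_sub_jet_le n f.contDiff x v
    (C := (Fintype.card ι).descFactorial (n + 1) * ‖f‖ *
      (K + R) ^ (Fintype.card ι - (n + 1))) ?_).trans (by gcongr)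
  intro t ht
  refine (f.norm_iteratedFDeriv_le (n + 1) _).trans ?_
  gcongr
  refine (norm_add_le _ _).trans (add_le_add hx ?_)
  rw [norm_smul, Real.norm_eq_abs, abs_of_nonneg ht.1]
  exact (mul_le_of_le_one_left (norm_nonneg _) ht.2).trans hv

theorem iteratedFDeriv_comp_affine (f : ContinuousMultilinearMap ℝ E F) (a : ∀ i, E i)
    (L : P →L[ℝ] ∀ i, E i) (n : ℕ) (w : P) :
    _root_.iteratedFDeriv ℝ n (fun w => f (a + L w)) w =
      (_root_.iteratedFDeriv ℝ n f (a + L w)).compContinuousLinearMap fun _ => L := by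
  change _root_.iteratedFDeriv ℝ n ((fun u => f (a + u)) ∘ L) w = _
  rw [L.iteratedFDeriv_comp_right (n := n) _ w le_rfl, iteratedFDeriv_comp_add_left]
  exact f.contDiff.comp (contDiff_const.add contDiff_id)

theorem contDiff_comp_affine (f : ContinuousMultilinearMap ℝ E F) (a : ∀ i, E i)
    (L : P →L[ℝ] ∀ i, E i) {n : WithTop ℕ∞} : ContDiff ℝ n (fun w => f (a + L w)) :=
  f.contDiff.comp (contDiff_const.add L.contDiff)

theorem iteratedFDeriv_comp_affine_eq_zero (f : ContinuousMultilinearMap ℝ E F) (a : ∀ i, E i)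
    (L : P →L[ℝ] ∀ i, E i) {n : ℕ} (hn : Fintype.card ι < n) (w : P) :
    _root_.iteratedFDeriv ℝ n (fun w => f (a + L w)) w = 0 := by
  have h := f.norm_iteratedFDeriv_le n (a + L w)
  rw [Nat.descFactorial_of_lt hn, Nat.cast_zero, zero_mul, zero_mul, norm_le_zero_iff] at h
  rw [iteratedFDeriv_comp_affine, h]
  rfl

end ContinuousMultilinearMap

/-! ### Top-order derivatives of multi-affine maps, and lower bounds from restriction to directions
-/

section TopDerivative

variable {B : ℕ} {E : Fin B → Type*} [∀ i, NormedAddCommGroup (E i)]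
  [∀ i, NormedSpace ℝ (E i)] {F : Type*} [NormedAddCommGroup F] [NormedSpace ℝ F]
  {P : Type*} [NormedAddCommGroup P] [NormedSpace ℝ P]

/-- If the direction `v i` moves only the `i`-th variable of a multilinear map, the derivative of
top order along `v` is the value of the map at the displacements. -/
theorem iteratedFDeriv_comp_affine_apply_of_diagonal (f : ContinuousMultilinearMap ℝ E F)
    (a : ∀ i, E i) (L : P →L[ℝ] ∀ i, E i) (w : P) (v : Fin B → P)
    (hv : ∀ i j, i ≠ j → L (v i) j = 0) :
    iteratedFDeriv ℝ B (fun w => f (a + L w)) w v = f fun i => L (v i) i := by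
  classical
  rw [f.iteratedFDeriv_comp_affine, ContinuousMultilinearMap.compContinuousLinearMap_apply,
    f.iteratedFDeriv_apply_eq_sum,
    Finset.sum_eq_single (Function.Embedding.refl (Fin B))]
  · congr 1
    ext i
    have h : i ∈ Set.range (Function.Embedding.refl (Fin B)) := ⟨i, rfl⟩
    rw [dif_pos h]
    refine congrArg (fun k => L (v k) i) ?_
    rw [Equiv.symm_apply_eq]; rfl
  -- An embedding other than the identity puts some `v i` into a slot `e i ≠ i`, where its
  -- displacement is zero.
  · intro e _ he
    obtain ⟨i, hi⟩ : ∃ i, e i ≠ i := by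
      by_contra! h
      exact he (by ext i; simp [h i])
    refine f.map_coord_zero (e i) ?_
    have h : e i ∈ Set.range e := ⟨i, rfl⟩
    rw [dif_pos h]
    refine (congrArg (fun k => L (v k) (e i)) (?_ : _ = i)).trans (hv i (e i) hi.symm)
    rw [Equiv.symm_apply_eq]; rfl
  · simp

/-- A map which is multi-affine with linear part `c` along the directions `v` has top derivative
of size at least `‖f c‖`. -/
theorem le_norm_iteratedFDeriv_of_restrict (f : ContinuousMultilinearMap ℝ E F) {G : P → F}
    (hG : ContDiff ℝ ∞ G) (w : P) (v : Fin B → P) (hv : ∀ i, ‖v i‖ ≤ 1) (a c : ∀ i, E i)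
    (h : ∀ t : Fin B → ℝ, G (w + ∑ i, t i • v i) = f fun i => a i + t i • c i) :
    ‖f c‖ ≤ ‖iteratedFDeriv ℝ B G w‖ := by
  classical
  -- `S` spreads the parameters `t` along the directions `v`, and `L` moves slot `i` along `c i`.
  -- The mixed derivative in all the `t i` at zero is then computed in two ways, in `h1` and `h2`.
  let S : (Fin B → ℝ) →L[ℝ] P :=
    ∑ i, (ContinuousLinearMap.proj (R := ℝ) (φ := fun _ : Fin B => ℝ) i).smulRight (v i)
  let L : (Fin B → ℝ) →L[ℝ] ∀ i, E i :=
    ContinuousLinearMap.pi fun i =>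
      (ContinuousLinearMap.proj (R := ℝ) (φ := fun _ : Fin B => ℝ) i).smulRight (c i)
  have hS : ∀ t, S t = ∑ i, t i • v i := fun t => by simp [S, _root_.sum_apply]
  have hSL : (fun u => G (w + u)) ∘ S = fun t => f (a + L t) := by
    ext t
    simp only [Function.comp, hS, h]
    rfl
  have h1 : iteratedFDeriv ℝ B ((fun u => G (w + u)) ∘ S) 0 (fun i => Pi.single i 1) =
      iteratedFDeriv ℝ B G w v := by
    rw [S.iteratedFDeriv_comp_right (n := ∞) (f := fun u => G (w + u)) (hG.comp (contDiff_const.add contDiff_id)) 0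
      (by exact_mod_cast le_top), iteratedFDeriv_comp_add_left,
      ContinuousMultilinearMap.compContinuousLinearMap_apply, map_zero, add_zero]
    congr 1
    ext i
    rw [hS, Finset.sum_eq_single i] <;> simp +contextual
  have h2 : iteratedFDeriv ℝ B ((fun u => G (w + u)) ∘ S) 0 (fun i => Pi.single i 1) = f c := by
    rw [hSL, iteratedFDeriv_comp_affine_apply_of_diagonal]
    · congr 1
      ext i
      simp [L]
    · intro i j hij
      simp [L, hij.symm]
  rw [← h2, h1]
  refine ((iteratedFDeriv ℝ B G w).le_opNorm v).trans ?_
  refine mul_le_of_le_one_right (norm_nonneg _) (Finset.prod_le_one (fun _ _ => norm_nonneg _) ?_)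
  exact fun i _ => hv i

end TopDerivative

/-! ### Compositions of continuous linear maps -/

section Chain

variable {n : ℕ} {V : Fin (n + 1) → Type*} [∀ i, NormedAddCommGroup (V i)]
  [∀ i, NormedSpace ℝ (V i)]

/-- The compositions `A (i - 1) ∘ ⋯ ∘ A 0` of a sequence of continuous linear maps. -/
noncomputable def chain (A : ∀ i : Fin n, V i.castSucc →L[ℝ] V i.succ) :
    ∀ i : Fin (n + 1), V 0 →L[ℝ] V i :=
  Fin.induction (ContinuousLinearMap.id ℝ (V 0)) (fun i T => (A i).comp T)

theorem chain_zero (A : ∀ i : Fin n, V i.castSucc →L[ℝ] V i.succ) :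
    chain A 0 = ContinuousLinearMap.id ℝ (V 0) := rfl

theorem chain_succ (A : ∀ i : Fin n, V i.castSucc →L[ℝ] V i.succ) (i : Fin n) :
    chain A i.succ = (A i).comp (chain A i.castSucc) := by
  simp [chain]

theorem chain_congr {A A' : ∀ i : Fin n, V i.castSucc →L[ℝ] V i.succ} (i : Fin (n + 1))
    (h : ∀ j : Fin n, j.castSucc < i → A j = A' j) : chain A i = chain A' i := by
  induction i using Fin.induction with
  | zero => rfl
  | succ i ih =>
    rw [chain_succ, chain_succ, h i (Fin.castSucc_lt_succ),
      ih fun j hj => h j (hj.trans Fin.castSucc_lt_succ)]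

/-- With all factors but one frozen, the composition is `a ↦ T ∘ a ∘ S`: the factors before `p` do
not see the update and those after it form `T`. Linearity in each factor follows. -/
theorem chain_update_of_lt (A : ∀ i : Fin n, V i.castSucc →L[ℝ] V i.succ) (p : Fin n)
    (i : Fin (n + 1)) (hi : p.castSucc < i) : ∃ T : V p.succ →L[ℝ] V i,
      ∀ a, chain (Function.update A p a) i = T.comp (a.comp (chain A p.castSucc)) := by
  induction i using Fin.induction with
  | zero => exact absurd hi (Fin.not_lt_zero _)
  | succ i ih =>
    rcases eq_or_ne i p with rfl | hip
    · refine ⟨ContinuousLinearMap.id ℝ _, fun a => ?_⟩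
      rw [chain_succ, Function.update_self, chain_congr (A' := A) i.castSucc]
      · ext; rfl
      · intro j hj
        rw [Function.update_of_ne]
        rintro rfl
        exact lt_irrefl _ hj
    · have hlt : p.castSucc < i.castSucc := by
        rcases lt_or_eq_of_le (Fin.castSucc_lt_succ_iff.1 hi) with h | h
        · exact h
        · exact absurd h.symm hip
      obtain ⟨T, hT⟩ := ih hlt
      refine ⟨(A i).comp T, fun a => ?_⟩
      rw [chain_succ, Function.update_of_ne hip, hT]
      rfl

theorem norm_chain_le (A : ∀ i : Fin n, V i.castSucc →L[ℝ] V i.succ) (i : Fin (n + 1)) :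
    ‖chain A i‖ ≤ ∏ j : Fin n with j.castSucc < i, ‖A j‖ := by
  induction i using Fin.induction with
  | zero => simpa [chain_zero] using ContinuousLinearMap.norm_id_le
  | succ i ih =>
    have h : (Finset.univ.filter fun j : Fin n => j.castSucc < i.succ) =
        insert i (Finset.univ.filter fun j : Fin n => j.castSucc < i.castSucc) := by
      ext j
      simp [Fin.castSucc_lt_succ_iff, le_iff_eq_or_lt]
    rw [chain_succ, h, Finset.prod_insert (by simp)]
    exact (ContinuousLinearMap.opNorm_comp_le _ _).trans (by gcongr)

theorem norm_chain_last_le (A : ∀ i : Fin n, V i.castSucc →L[ℝ] V i.succ) :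
    ‖chain A (Fin.last n)‖ ≤ ∏ j, ‖A j‖ := by
  refine (norm_chain_le A _).trans_eq ?_
  rw [Finset.filter_true_of_mem]
  exact fun j _ => Fin.castSucc_lt_last j

/-- Composition of a sequence of continuous linear maps, as a continuous multilinear map. -/
noncomputable def chainMultilinear (V : Fin (n + 1) → Type*) [∀ i, NormedAddCommGroup (V i)]
    [∀ i, NormedSpace ℝ (V i)] :
    ContinuousMultilinearMap ℝ (fun i : Fin n => V i.castSucc →L[ℝ] V i.succ)
      (V 0 →L[ℝ] V (Fin.last n)) :=
  MultilinearMap.mkContinuous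
    { toFun := fun A => chain A (Fin.last n)
      map_update_add' := by
        intro dec A p a b
        -- The fields of `MultilinearMap` quantify over all decidability instances, whereas
        -- `chain_update_of_lt` uses the canonical one.
        rw [Subsingleton.elim dec (instDecidableEqFin n)]
        obtain ⟨T, hT⟩ := chain_update_of_lt A p (Fin.last n) (Fin.castSucc_lt_last p)
        rw [hT, hT, hT, ContinuousLinearMap.add_comp, ContinuousLinearMap.comp_add]
      map_update_smul' := by
        intro dec A p s a
        rw [Subsingleton.elim dec (instDecidableEqFin n)]
        obtain ⟨T, hT⟩ := chain_update_of_lt A p (Fin.last n) (Fin.castSucc_lt_last p)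
        rw [hT, hT, ContinuousLinearMap.smul_comp, ContinuousLinearMap.comp_smul] }
    1 (fun A => by simpa using norm_chain_last_le A)

end Chain

/-! ### Matrices as operators between Euclidean spaces -/

section MatCLM

variable {a b : ℕ}

/-- The operator between Euclidean spaces given by a matrix. -/
noncomputable def matCLM : Matrix (Fin a) (Fin b) ℝ →ₗ[ℝ]
    (EuclideanSpace ℝ (Fin b) →L[ℝ] EuclideanSpace ℝ (Fin a)) :=
  LinearMap.toContinuousLinearMap.toLinearMap ∘ₗ (Matrix.toLpLin 2 2).toLinearMap

theorem matCLM_apply_apply (A : Matrix (Fin a) (Fin b) ℝ) (z : EuclideanSpace ℝ (Fin b))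
    (i : Fin a) : matCLM A z i = ∑ j, A i j * z j := rfl

/-- Cauchy–Schwarz in each row. This is how Frobenius balls and the Euclidean norm of parameters
control operator norms. -/
theorem norm_matCLM_le (A : Matrix (Fin a) (Fin b) ℝ) :
    ‖matCLM A‖ ≤ √(∑ i, ∑ j, A i j ^ 2) := by
  refine ContinuousLinearMap.opNorm_le_bound _ (Real.sqrt_nonneg _) fun z => ?_
  rw [EuclideanSpace.norm_eq, EuclideanSpace.norm_eq, ← Real.sqrt_mul (by positivity),
    Finset.sum_mul]
  refine Real.sqrt_le_sqrt (Finset.sum_le_sum fun i _ => ?_)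
  simp only [Real.norm_eq_abs, sq_abs, matCLM_apply_apply]
  exact Finset.sum_mul_sq_le_sq_mul_sq _ _ _

end MatCLM

/-! ### The wide network as a multilinear map of its layers -/

section Block

/-- The space of values of a node layer of a wide network. -/
abbrev NodeSpace (m k din dout : ℕ) (ℓ : Fin (k + 3)) : Type :=
  EuclideanSpace ℝ (Fin (layerWidth m k din dout ℓ))

/-- The space of operators in which a weight matrix lives. -/
abbrev LayerSpace (m k din dout : ℕ) (ℓ : Fin (k + 2)) : Type :=
  NodeSpace m k din dout ℓ.castSucc →L[ℝ] NodeSpace m k din dout ℓ.succ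

/-- Relabelling of coordinates along an equality of dimensions. -/
noncomputable def euclideanCast {a b : ℕ} (h : a = b) :
    EuclideanSpace ℝ (Fin a) ≃ₗᵢ[ℝ] EuclideanSpace ℝ (Fin b) :=
  LinearIsometryEquiv.piLpCongrLeft 2 ℝ ℝ (finCongr h)

theorem euclideanCast_apply {a b : ℕ} (h : a = b) (z : EuclideanSpace ℝ (Fin a)) (i : Fin b) :
    euclideanCast h z i = z (Fin.cast h.symm i) := by
  subst h
  simp [euclideanCast, LinearIsometryEquiv.piLpCongrLeft_apply]

variable (m k din dout : ℕ)

/-- The product of the normalizations of the layers of a wide network. -/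
noncomputable def blockScale : ℝ :=
  ∏ ℓ : Fin (k + 2), 1 / √(layerWidth m k din dout ℓ.castSucc : ℝ)

/-- Relabelling of the endpoints of a chain of operators, with normalization. -/
noncomputable def blockFrame :
    (NodeSpace m k din dout 0 →L[ℝ] NodeSpace m k din dout (Fin.last (k + 2))) →L[ℝ]
      (EuclideanSpace ℝ (Fin din) →L[ℝ] EuclideanSpace ℝ (Fin dout)) :=
  blockScale m k din dout •
    ((ContinuousLinearMap.compL ℝ (EuclideanSpace ℝ (Fin din)) (NodeSpace m k din dout 0)
      (EuclideanSpace ℝ (Fin dout))).flip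
      (euclideanCast (layerWidth_zero m k din dout).symm).toContinuousLinearEquiv).comp
    (ContinuousLinearMap.compL ℝ (NodeSpace m k din dout 0)
      (NodeSpace m k din dout (Fin.last (k + 2))) (EuclideanSpace ℝ (Fin dout))
      (euclideanCast (layerWidth_last m k din dout)).toContinuousLinearEquiv)

/-- The wide network as a multilinear map of its layers, with values in operators. -/
noncomputable def blockMap :
    ContinuousMultilinearMap ℝ (LayerSpace m k din dout)
      (EuclideanSpace ℝ (Fin din) →L[ℝ] EuclideanSpace ℝ (Fin dout)) :=
  (blockFrame m k din dout).compContinuousMultilinearMap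
    (chainMultilinear (NodeSpace m k din dout))

variable {m k din dout}

theorem blockScale_nonneg : 0 ≤ blockScale m k din dout :=
  Finset.prod_nonneg fun _ _ => by positivity

theorem blockScale_eq : blockScale m k din dout = 1 / √(din : ℝ) * (1 / √(m : ℝ)) ^ (k + 1) := by
  rw [blockScale, Fin.prod_univ_succ]
  congr 1
  · have h : ∀ i : Fin (k + 1), layerWidth m k din dout i.succ.castSucc = m := by
      intro i
      have h2 : i.succ.castSucc ≠ Fin.last (k + 2) := (Fin.castSucc_lt_last _).ne
      rw [layerWidth, if_neg, if_neg h2]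
      rw [Fin.ext_iff]; simp
    simp only [h, Finset.prod_const, Finset.card_univ, Fintype.card_fin]

theorem blockScale_le (hd : 1 ≤ din) :
    blockScale m k din dout ≤ (1 / √(m : ℝ)) ^ (k + 1) := by
  rw [blockScale_eq]
  refine mul_le_of_le_one_left (by positivity) ?_
  rw [div_le_one (Real.sqrt_pos.2 (by exact_mod_cast hd))]
  exact Real.one_le_sqrt.2 (by exact_mod_cast hd)

theorem blockMap_apply (A : ∀ ℓ, LayerSpace m k din dout ℓ) (z : EuclideanSpace ℝ (Fin din)) :
    blockMap m k din dout A z = blockScale m k din dout •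
      euclideanCast (layerWidth_last m k din dout) (chain A (Fin.last (k + 2))
        (euclideanCast (layerWidth_zero m k din dout).symm z)) := rfl

theorem norm_blockMap_apply (A : ∀ ℓ, LayerSpace m k din dout ℓ)
    (z : EuclideanSpace ℝ (Fin din)) :
    ‖blockMap m k din dout A z‖ = blockScale m k din dout * ‖chain A (Fin.last (k + 2))
        (euclideanCast (layerWidth_zero m k din dout).symm z)‖ := by
  rw [blockMap_apply, norm_smul, Real.norm_eq_abs, abs_of_nonneg blockScale_nonneg,
    LinearIsometryEquiv.norm_map]

theorem norm_blockMap_le : ‖blockMap m k din dout‖ ≤ blockScale m k din dout := by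
  refine ContinuousMultilinearMap.opNorm_le_bound blockScale_nonneg fun A => ?_
  refine ContinuousLinearMap.opNorm_le_bound _
    (mul_nonneg blockScale_nonneg (Finset.prod_nonneg fun _ _ => norm_nonneg _)) fun z => ?_
  rw [norm_blockMap_apply, mul_assoc]
  refine mul_le_mul_of_nonneg_left ?_ blockScale_nonneg
  refine (ContinuousLinearMap.le_opNorm _ _).trans ?_
  rw [LinearIsometryEquiv.norm_map]
  gcongr
  exact norm_chain_last_le A

/-- Stated for every node layer, with the partial product of the normalizations, so that induction
on the layer applies. -/
theorem wnnNodes_eq_chain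
    (W : ∀ ℓ : Fin (k + 2), Matrix (Fin (layerWidth m k din dout ℓ.succ))
      (Fin (layerWidth m k din dout ℓ.castSucc)) ℝ) (z : Fin din → ℝ) (i : Fin (k + 3)) :
    WithLp.toLp 2 (wnnNodes m k din dout W z i) =
      (∏ j : Fin (k + 2) with j.castSucc < i, 1 / √(layerWidth m k din dout j.castSucc : ℝ)) •
        (chain (V := NodeSpace m k din dout) (fun ℓ => matCLM (W ℓ)) i
          (euclideanCast (layerWidth_zero m k din dout).symm (WithLp.toLp 2 z))) := by
  induction i using Fin.induction with
  | zero =>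
    simp only [Fin.not_lt_zero, Finset.filter_false, Finset.prod_empty, one_smul, chain_zero,
      ContinuousLinearMap.id_apply]
    ext i
    rw [euclideanCast_apply]
    simp [wnnNodes]
  | succ i ih =>
    have h : (Finset.univ.filter fun j : Fin (k + 2) => j.castSucc < i.succ) =
        insert i (Finset.univ.filter fun j : Fin (k + 2) => j.castSucc < i.castSucc) := by
      ext j
      simp [Fin.castSucc_lt_succ_iff, le_iff_eq_or_lt]
    have hstep : WithLp.toLp 2 (wnnNodes m k din dout W z i.succ) =
        (1 / √(layerWidth m k din dout i.castSucc : ℝ)) •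
          matCLM (W i) (WithLp.toLp 2 (wnnNodes m k din dout W z i.castSucc)) := by
      simp only [wnnNodes, Fin.induction_succ]
      rfl
    rw [hstep, ih, h, Finset.prod_insert (by simp), chain_succ, map_smul, smul_smul]
    rfl

theorem toLp_wnn_eq_blockMap
    (W : ∀ ℓ : Fin (k + 2), Matrix (Fin (layerWidth m k din dout ℓ.succ))
      (Fin (layerWidth m k din dout ℓ.castSucc)) ℝ) (z : Fin din → ℝ) :
    WithLp.toLp 2 (wnn m k din dout W z) =
      blockMap m k din dout (fun ℓ => matCLM (W ℓ)) (WithLp.toLp 2 z) := by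
  have h := wnnNodes_eq_chain W z (Fin.last (k + 2))
  rw [Finset.filter_true_of_mem (fun j _ => Fin.castSucc_lt_last j)] at h
  rw [blockMap_apply, ← map_smul, blockScale, ← h]
  ext i
  rw [euclideanCast_apply]
  rfl

end Block

/-! ### The bottleneck network as a multilinear map of its layers -/

section Network

variable {B : ℕ} (d : Fin (B + 1) → ℕ) (k : Fin B → ℕ) (m : ℕ)

/-- The space of operators in which the weight matrix of a layer of the network lives. -/
abbrev NetLayer (p : LayerIdx k) : Type :=
  LayerSpace m (k p.1) (d p.1.castSucc) (d p.1.succ) p.2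

/-- The operator of a weight matrix, as a linear function of the tuple of weights. -/
noncomputable def layerCLM (p : LayerIdx k) : Params d k m →L[ℝ] NetLayer d k m p :=
  LinearMap.toContinuousLinearMap
    { toFun := fun W => matCLM (weightMatrix W p.1 p.2)
      map_add' := fun U V => by rw [← map_add]; rfl
      map_smul' := fun t U => by rw [← map_smul]; rfl }

/-- The operators of all weight matrices, as a linear function of the tuple of weights. -/
noncomputable def layersCLM : Params d k m →L[ℝ] ∀ p, NetLayer d k m p :=
  ContinuousLinearMap.pi fun p => layerCLM d k m p

/-- The operators of the weight matrices of a block. -/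
noncomputable def blockLayersCLM (b : Fin B) :
    Params d k m →L[ℝ] ∀ ℓ, LayerSpace m (k b) (d b.castSucc) (d b.succ) ℓ :=
  ContinuousLinearMap.pi fun ℓ => layerCLM d k m ⟨b, ℓ⟩

/-- The operators of the blocks of the network, as functions of the weights. -/
noncomputable def blockOps (W : Params d k m) (b : Fin B) :
    EuclideanSpace ℝ (Fin (d b.castSucc)) →L[ℝ] EuclideanSpace ℝ (Fin (d b.succ)) :=
  blockMap m (k b) (d b.castSucc) (d b.succ) (blockLayersCLM d k m b W)

/-- The composition of the blocks applied to the input, as a multilinear map of the blocks. -/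
noncomputable def outerMap (x : EuclideanSpace ℝ (Fin (d 0))) :
    ContinuousMultilinearMap ℝ (fun b : Fin B =>
      EuclideanSpace ℝ (Fin (d b.castSucc)) →L[ℝ] EuclideanSpace ℝ (Fin (d b.succ)))
      (EuclideanSpace ℝ (Fin (d (Fin.last B)))) :=
  (ContinuousLinearMap.apply ℝ _ x).compContinuousMultilinearMap
    (chainMultilinear fun b => EuclideanSpace ℝ (Fin (d b)))

variable {d k m}

theorem layersCLM_apply (W : Params d k m) (p : LayerIdx k) :
    layersCLM d k m W p = matCLM (weightMatrix W p.1 p.2) := rfl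

theorem blockLayersCLM_apply (b : Fin B) (W : Params d k m) (ℓ : Fin (k b + 2)) :
    blockLayersCLM d k m b W ℓ = matCLM (weightMatrix W b ℓ) := rfl

theorem outerMap_apply (x : EuclideanSpace ℝ (Fin (d 0)))
    (T : ∀ b : Fin B,
      EuclideanSpace ℝ (Fin (d b.castSucc)) →L[ℝ] EuclideanSpace ℝ (Fin (d b.succ))) :
    outerMap d x T =
      chain (V := fun b => EuclideanSpace ℝ (Fin (d b))) T (Fin.last B) x := rfl

theorem norm_outerMap_apply_le (x : EuclideanSpace ℝ (Fin (d 0)))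
    (T : ∀ b : Fin B,
      EuclideanSpace ℝ (Fin (d b.castSucc)) →L[ℝ] EuclideanSpace ℝ (Fin (d b.succ))) :
    ‖outerMap d x T‖ ≤ ‖x‖ * ∏ b, ‖T b‖ := by
  rw [outerMap_apply, mul_comm]
  refine (ContinuousLinearMap.le_opNorm _ _).trans ?_
  gcongr
  exact norm_chain_last_le (V := fun b => EuclideanSpace ℝ (Fin (d b))) T

theorem norm_outerMap_le (x : EuclideanSpace ℝ (Fin (d 0))) : ‖outerMap d x‖ ≤ ‖x‖ :=
  ContinuousMultilinearMap.opNorm_le_bound (norm_nonneg _) (norm_outerMap_apply_le x)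

theorem bnn_eq_outerMap (x : EuclideanSpace ℝ (Fin (d 0))) (W : Params d k m) :
    bnn x W = outerMap d x (blockOps d k m W) := by
  rw [outerMap_apply, bnn]
  have h : ∀ i : Fin (B + 1), WithLp.toLp 2 (bnnNodes W x.ofLp i) =
      chain (V := fun b => EuclideanSpace ℝ (Fin (d b))) (blockOps d k m W) i x := by
    intro i
    induction i using Fin.induction with
    | zero => rfl
    | succ i ih =>
      rw [chain_succ, ContinuousLinearMap.comp_apply, ← ih]
      have hstep : bnnNodes W x.ofLp i.succ = wnn m (k i) (d i.castSucc) (d i.succ)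
          (weightMatrix W i) (bnnNodes W x.ofLp i.castSucc) := by
        simp [bnnNodes]
      rw [hstep, toLp_wnn_eq_blockMap]
      rfl
  exact h (Fin.last B)

variable (d k m)

/-- The network applied to the input, as a multilinear map of its layers. -/
noncomputable def netMap (x : EuclideanSpace ℝ (Fin (d 0))) :
    ContinuousMultilinearMap ℝ (NetLayer d k m) (EuclideanSpace ℝ (Fin (d (Fin.last B)))) :=
  MultilinearMap.mkContinuous
    ((outerMap d x).toMultilinearMap.compMultilinearMap fun b : Fin B =>
      (blockMap m (k b) (d b.castSucc) (d b.succ)).toMultilinearMap)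
    (‖x‖ * ∏ b : Fin B, blockScale m (k b) (d b.castSucc) (d b.succ)) (by
      intro A
      refine (norm_outerMap_apply_le x _).trans ?_
      rw [mul_assoc, Fintype.prod_sigma, ← Finset.prod_mul_distrib]
      refine mul_le_mul_of_nonneg_left ?_ (norm_nonneg _)
      refine Finset.prod_le_prod (fun _ _ => norm_nonneg _) fun b _ => ?_
      refine ((blockMap m (k b) (d b.castSucc) (d b.succ)).le_opNorm _).trans ?_
      exact mul_le_mul_of_nonneg_right norm_blockMap_le
        (Finset.prod_nonneg fun _ _ => norm_nonneg _))

variable {d k m}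

theorem bnn_eq_netMap (x : EuclideanSpace ℝ (Fin (d 0))) :
    (bnn x : Params d k m → _) = netMap d k m x ∘ layersCLM d k m := by
  ext1 W
  rw [bnn_eq_outerMap]
  rfl

theorem contDiff_bnn (x : EuclideanSpace ℝ (Fin (d 0))) {n : WithTop ℕ∞} :
    ContDiff ℝ n (bnn x : Params d k m → _) := by
  rw [bnn_eq_netMap]
  exact (netMap d k m x).contDiff.comp (layersCLM d k m).contDiff

/-- Each block contributes one factor `1 / √m` per hidden layer; its first layer is normalized by
the fixed input dimension, and that factor is at most one. The exponent is the number of layers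
minus `B`. -/
theorem norm_netMap_le (hd : ∀ b, 1 ≤ d b) (x : EuclideanSpace ℝ (Fin (d 0))) :
    ‖netMap d k m x‖ ≤ ‖x‖ * (1 / √(m : ℝ)) ^ (∑ b, (k b + 1)) := by
  refine (MultilinearMap.mkContinuous_norm_le _
    (mul_nonneg (norm_nonneg _) (Finset.prod_nonneg fun _ _ => blockScale_nonneg)) _).trans ?_
  rw [← Finset.prod_pow_eq_pow_sum]
  gcongr with b
  · exact fun _ _ => blockScale_nonneg
  · exact blockScale_le (hd _)

theorem sum_sq_weightMatrix_le (W : Params d k m) (p : LayerIdx k) :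
    ∑ i, ∑ j, weightMatrix W p.1 p.2 i j ^ 2 ≤ ‖W‖ ^ 2 := by
  rw [EuclideanSpace.real_norm_sq_eq, Fintype.sum_sigma, ← Fintype.sum_prod_type']
  exact Finset.single_le_sum
    (f := fun p : LayerIdx k => ∑ y, W ⟨p, y⟩ ^ 2)
    (fun _ _ => Finset.sum_nonneg fun _ _ => sq_nonneg _) (Finset.mem_univ p)

theorem norm_layersCLM_le : ‖layersCLM d k m‖ ≤ 1 := by
  refine ContinuousLinearMap.opNorm_le_bound _ zero_le_one fun W => ?_
  rw [one_mul, pi_norm_le_iff_of_nonneg (norm_nonneg _)]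
  intro p
  rw [layersCLM_apply]
  refine (norm_matCLM_le _).trans (Real.sqrt_le_iff.2 ⟨norm_nonneg _, ?_⟩)
  exact sum_sq_weightMatrix_le W p

theorem norm_layersCLM_sub_le {W₀ W : Params d k m} {R : ℝ} (hR : 0 ≤ R)
    (hW : W ∈ weightBall W₀ R) : ‖layersCLM d k m (W - W₀)‖ ≤ R := by
  rw [pi_norm_le_iff_of_nonneg hR]
  intro p
  rw [layersCLM_apply]
  exact (norm_matCLM_le _).trans (hW p.1 p.2)

theorem card_layerIdx : Fintype.card (LayerIdx k) = ∑ b, (k b + 1) + B := by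
  simp only [LayerIdx, Fintype.card_sigma, Fintype.card_fin]
  rw [show (∑ b, (k b + 2)) = ∑ b, (k b + 1 + 1) from rfl, Finset.sum_add_distrib]
  simp

theorem le_sum_depth : B ≤ ∑ b, (k b + 1) := by
  calc B = ∑ _b : Fin B, 1 := by simp
    _ ≤ _ := Finset.sum_le_sum fun _ _ => by omega

/-- Powers of the width in the derivative of order `B + 1` of the network. -/
theorem width_power_bound (hB : 1 ≤ B) (hd : ∀ b, 1 ≤ d b) (x : EuclideanSpace ℝ (Fin (d 0)))
    (hm : 1 ≤ m) {K : ℝ} (hK : 0 ≤ K) :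
    ((Fintype.card (LayerIdx k)).descFactorial (B + 1) : ℝ) * ‖netMap d k m x‖ *
      (K * √(m : ℝ)) ^ (Fintype.card (LayerIdx k) - (B + 1)) ≤
    ((Fintype.card (LayerIdx k)).descFactorial (B + 1) : ℝ) *
      K ^ (Fintype.card (LayerIdx k) - (B + 1)) * ‖x‖ / √(m : ℝ) := by
  have hs : 0 < √(m : ℝ) := Real.sqrt_pos.2 (by exact_mod_cast hm)
  have hS := le_sum_depth (k := k)
  -- There are `s + 1 + B` layers. The norm gives `s + 1` factors `1 / √m`, the `s` slots left after
  -- `B + 1` derivatives give `√m` each, and one factor `1 / √m` survives.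
  obtain ⟨s, hs'⟩ : ∃ s, ∑ b, (k b + 1) = s + 1 := ⟨∑ b, (k b + 1) - 1, by omega⟩
  have hcard : Fintype.card (LayerIdx k) - (B + 1) = s := by
    rw [card_layerIdx, hs']; omega
  have h1 := norm_netMap_le (k := k) (m := m) hd x
  rw [hs'] at h1
  rw [hcard]
  calc _ ≤ ((Fintype.card (LayerIdx k)).descFactorial (B + 1) : ℝ) *
        (‖x‖ * (1 / √(m : ℝ)) ^ (s + 1)) * (K * √(m : ℝ)) ^ s := by gcongr
    _ = _ := by
      rw [one_div, inv_pow, mul_pow]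
      field_simp
      ring

theorem norm_iteratedFDeriv_bnn_le (hB : 1 ≤ B) (hd : ∀ b, 1 ≤ d b)
    (x : EuclideanSpace ℝ (Fin (d 0))) (hm : 1 ≤ m) {K : ℝ} (hK : 0 ≤ K) (W : Params d k m)
    (hW : ‖layersCLM d k m W‖ ≤ K * √(m : ℝ)) :
    ‖iteratedFDeriv ℝ (B + 1) (bnn (d := d) (k := k) (m := m) x) W‖ ≤
      ((Fintype.card (LayerIdx k)).descFactorial (B + 1) : ℝ) *
      K ^ (Fintype.card (LayerIdx k) - (B + 1)) * ‖x‖ / √(m : ℝ) := by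
  rw [bnn_eq_netMap]
  exact ((netMap d k m x).norm_iteratedFDeriv_comp_clm_le _ norm_layersCLM_le (B + 1) W hW).trans
    (width_power_bound hB hd x hm hK)

theorem norm_layersCLM_le_of_mem (hm : 1 ≤ m) {K R : ℝ} (hR : 0 ≤ R) {W₀ W : Params d k m}
    (hW₀ : ‖layersCLM d k m W₀‖ ≤ K * √(m : ℝ)) (hW : W ∈ weightBall W₀ R) :
    ‖layersCLM d k m W‖ ≤ (K + R) * √(m : ℝ) := by
  have h1 : 1 ≤ √(m : ℝ) := Real.one_le_sqrt.2 (by exact_mod_cast hm)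
  have h : layersCLM d k m W = layersCLM d k m W₀ + layersCLM d k m (W - W₀) := by
    rw [← map_add]; simp
  rw [h]
  refine (norm_add_le _ _).trans ?_
  have := norm_layersCLM_sub_le hR hW
  nlinarith

theorem norm_bnn_sub_jet_le (hB : 1 ≤ B) (hd : ∀ b, 1 ≤ d b)
    (x : EuclideanSpace ℝ (Fin (d 0))) (hm : 1 ≤ m) {K R : ℝ} (hK : 0 ≤ K) (hR : 0 ≤ R)
    {W₀ W : Params d k m} (hW₀ : ‖layersCLM d k m W₀‖ ≤ K * √(m : ℝ)) (hW : W ∈ weightBall W₀ R) :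
    ‖bnn x W - jet B (bnn x) W₀ (W - W₀)‖ ≤
      ((Fintype.card (LayerIdx k)).descFactorial (B + 1) : ℝ) *
      (K + R) ^ (Fintype.card (LayerIdx k) - (B + 1)) * R ^ (B + 1) * ‖x‖ / √(m : ℝ) := by
  have h1 : 1 ≤ √(m : ℝ) := Real.one_le_sqrt.2 (by exact_mod_cast hm)
  rw [bnn_eq_netMap, jet_comp_clm B (netMap d k m x).contDiff]
  have h : (netMap d k m x ∘ layersCLM d k m) W =
      netMap d k m x (layersCLM d k m W₀ + layersCLM d k m (W - W₀)) := by
    rw [← map_add]; simp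
  rw [h]
  refine ((netMap d k m x).norm_map_add_sub_jet_le B _ _ hW₀
    (norm_layersCLM_sub_le hR hW)).trans ?_
  calc _ ≤ ((Fintype.card (LayerIdx k)).descFactorial (B + 1) : ℝ) * ‖netMap d k m x‖ *
      ((K + R) * √(m : ℝ)) ^ (Fintype.card (LayerIdx k) - (B + 1)) * R ^ (B + 1) := by
        gcongr
        -- Since `1 ≤ √m`, the radius `R` is absorbed: `K √m + R ≤ (K + R) √m`.
        nlinarith
    _ ≤ (((Fintype.card (LayerIdx k)).descFactorial (B + 1) : ℝ) *
      (K + R) ^ (Fintype.card (LayerIdx k) - (B + 1)) * ‖x‖ / √(m : ℝ)) * R ^ (B + 1) := by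
        gcongr
        exact width_power_bound hB hd x hm (add_nonneg hK hR)
    _ = _ := by ring

theorem weightMatrix_congr {U V : Params d k m} (b : Fin B) (ℓ : Fin (k b + 2))
    (h : ∀ i : WeightIdx d k m, i.1 = ⟨b, ℓ⟩ → U i = V i) :
    weightMatrix U b ℓ = weightMatrix V b ℓ := by
  ext i j
  exact h ⟨⟨b, ℓ⟩, i, j⟩ rfl

theorem isAffineInCoords_jet_bnn (n : ℕ) (x : EuclideanSpace ℝ (Fin (d 0))) (W₀ : Params d k m)
    (p : LayerIdx k) :
    IsAffineInCoords {i : WeightIdx d k m | i.1 = p}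
      (fun W : Params d k m => jet n (bnn x) W₀ (W - W₀)) := by
  intro U V hUV t
  simp only [bnn_eq_netMap, jet_comp_clm n (netMap d k m x).contDiff]
  have h : (1 - t) • U + t • V - W₀ = (1 - t) • (U - W₀) + t • (V - W₀) := by
    module
  rw [h, map_add, map_smul, map_smul]
  refine (netMap d k m x).jet_lineMap_of_eq_off n _ p _ _ (fun q hq => ?_) t
  rw [layersCLM_apply, layersCLM_apply, weightMatrix_congr]
  intro i hi
  have hip : i ∉ {i : WeightIdx d k m | i.1 = p} := fun hip => hq (hi.symm.trans hip)
  simp [hUV i hip]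

end Network

/-! ### A lower bound for the derivative of order `B` -/

section LowerBound

variable {B : ℕ} {d : Fin (B + 1) → ℕ} {k : Fin B → ℕ} {m : ℕ}

/-- The tuple of weights whose only nonzero weight matrix is `M`, in layer `p`. -/
noncomputable def singleLayer (p : LayerIdx k)
    (M : Matrix (Fin (layerWidth m (k p.1) (d p.1.castSucc) (d p.1.succ) p.2.succ))
      (Fin (layerWidth m (k p.1) (d p.1.castSucc) (d p.1.succ) p.2.castSucc)) ℝ) : Params d k m :=
  WithLp.toLp 2 fun i => (Pi.single p (fun y => M y.1 y.2) : ∀ q : LayerIdx k,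
    Fin (layerWidth m (k q.1) (d q.1.castSucc) (d q.1.succ) q.2.succ) ×
    Fin (layerWidth m (k q.1) (d q.1.castSucc) (d q.1.succ) q.2.castSucc) → ℝ) i.1 i.2

theorem weightMatrix_singleLayer_self (p : LayerIdx k)
    (M : Matrix (Fin (layerWidth m (k p.1) (d p.1.castSucc) (d p.1.succ) p.2.succ))
      (Fin (layerWidth m (k p.1) (d p.1.castSucc) (d p.1.succ) p.2.castSucc)) ℝ) :
    weightMatrix (singleLayer p M) p.1 p.2 = M := by
  ext i j
  simp [weightMatrix, singleLayer]

theorem weightMatrix_singleLayer_of_ne (p q : LayerIdx k) (h : q ≠ p)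
    (M : Matrix (Fin (layerWidth m (k p.1) (d p.1.castSucc) (d p.1.succ) p.2.succ))
      (Fin (layerWidth m (k p.1) (d p.1.castSucc) (d p.1.succ) p.2.castSucc)) ℝ) :
    weightMatrix (singleLayer p M) q.1 q.2 = 0 := by
  ext i j
  simp [weightMatrix, singleLayer, h]

theorem norm_sq_singleLayer (p : LayerIdx k)
    (M : Matrix (Fin (layerWidth m (k p.1) (d p.1.castSucc) (d p.1.succ) p.2.succ))
      (Fin (layerWidth m (k p.1) (d p.1.castSucc) (d p.1.succ) p.2.castSucc)) ℝ) :
    ‖singleLayer p M‖ ^ 2 = ∑ i, ∑ j, M i j ^ 2 := by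
  rw [EuclideanSpace.real_norm_sq_eq, Fintype.sum_sigma, Finset.sum_eq_single p,
    Fintype.sum_prod_type]
  · simp [singleLayer]
  · intro q _ hq
    simp [singleLayer, hq]
  · simp

theorem blockLayersCLM_singleLayer_self (b : Fin B) (ℓ : Fin (k b + 2))
    (M : Matrix (Fin (layerWidth m (k b) (d b.castSucc) (d b.succ) ℓ.succ))
      (Fin (layerWidth m (k b) (d b.castSucc) (d b.succ) ℓ.castSucc)) ℝ) :
    blockLayersCLM d k m b (singleLayer ⟨b, ℓ⟩ M) = Pi.single ℓ (matCLM M) := by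
  ext1 j
  rw [blockLayersCLM_apply]
  rcases eq_or_ne j ℓ with rfl | h
  · rw [weightMatrix_singleLayer_self ⟨b, j⟩ M, Pi.single_eq_same]
  · rw [weightMatrix_singleLayer_of_ne ⟨b, ℓ⟩ ⟨b, j⟩ (by simpa using h) M, Pi.single_eq_of_ne h,
      map_zero]

theorem blockLayersCLM_singleLayer_of_ne {b b' : Fin B} (hb : b' ≠ b) (ℓ : Fin (k b + 2))
    (M : Matrix (Fin (layerWidth m (k b) (d b.castSucc) (d b.succ) ℓ.succ))
      (Fin (layerWidth m (k b) (d b.castSucc) (d b.succ) ℓ.castSucc)) ℝ) :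
    blockLayersCLM d k m b' (singleLayer ⟨b, ℓ⟩ M) = 0 := by
  ext1 j
  rw [blockLayersCLM_apply, weightMatrix_singleLayer_of_ne ⟨b, ℓ⟩ ⟨b', j⟩ _ M, map_zero]
  · rfl
  · intro h
    exact hb (congrArg Sigma.fst h)

/-- The unnormalized node layers of block `b` on the input `z`. -/
noncomputable def blockNode (W : Params d k m) (b : Fin B)
    (z : EuclideanSpace ℝ (Fin (d b.castSucc))) (i : Fin (k b + 3)) :
    NodeSpace m (k b) (d b.castSucc) (d b.succ) i :=
  chain (V := NodeSpace m (k b) (d b.castSucc) (d b.succ)) (blockLayersCLM d k m b W) i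
    (euclideanCast (layerWidth_zero m (k b) (d b.castSucc) (d b.succ)).symm z)

theorem norm_blockNode_zero (W : Params d k m) (b : Fin B)
    (z : EuclideanSpace ℝ (Fin (d b.castSucc))) : ‖blockNode W b z 0‖ = ‖z‖ := by
  rw [blockNode, chain_zero, ContinuousLinearMap.id_apply, LinearIsometryEquiv.norm_map]

theorem blockNode_succ (W : Params d k m) (b : Fin B)
    (z : EuclideanSpace ℝ (Fin (d b.castSucc))) (ℓ : Fin (k b + 2)) :
    blockNode W b z ℓ.succ = matCLM (weightMatrix W b ℓ) (blockNode W b z ℓ.castSucc) := by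
  rw [blockNode, chain_succ]
  rfl

theorem norm_blockOps_apply (W : Params d k m) (b : Fin B)
    (z : EuclideanSpace ℝ (Fin (d b.castSucc))) :
    ‖blockOps d k m W b z‖ = blockScale m (k b) (d b.castSucc) (d b.succ) *
      ‖blockNode W b z (Fin.last _)‖ :=
  norm_blockMap_apply _ _

/-- The inputs of the blocks used for the lower bound: the input of the network for the first
block, a basis vector for the others. -/
noncomputable def startVec (hd : ∀ b, 1 ≤ d b) (x : EuclideanSpace ℝ (Fin (d 0))) :
    ∀ i : Fin (B + 1), EuclideanSpace ℝ (Fin (d i)) :=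
  Fin.cases x fun b => EuclideanSpace.single ⟨0, hd b.succ⟩ 1

theorem norm_startVec_succ (hd : ∀ b, 1 ≤ d b) (x : EuclideanSpace ℝ (Fin (d 0))) (b : Fin B) :
    ‖startVec hd x b.succ‖ = 1 := by
  simp [startVec]

/-- The last hidden node layer of a block, on the inputs used for the lower bound. -/
noncomputable def lastHidden (hd : ∀ b, 1 ≤ d b) (x : EuclideanSpace ℝ (Fin (d 0)))
    (W : Params d k m) (b : Fin B) :
    NodeSpace m (k b) (d b.castSucc) (d b.succ) (Fin.last (k b + 1)).castSucc :=
  blockNode W b (startVec hd x b.castSucc) (Fin.last (k b + 1)).castSucc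

/-- The rank-one perturbation of the last layer of a block used for the lower bound. -/
noncomputable def rankOneDir (hd : ∀ b, 1 ≤ d b) (x : EuclideanSpace ℝ (Fin (d 0)))
    (W : Params d k m) (b : Fin B) :
    Matrix (Fin (layerWidth m (k b) (d b.castSucc) (d b.succ) (Fin.last (k b + 1)).succ))
      (Fin (layerWidth m (k b) (d b.castSucc) (d b.succ) (Fin.last (k b + 1)).castSucc)) ℝ :=
  Matrix.of fun i j =>
    euclideanCast (layerWidth_last m (k b) (d b.castSucc) (d b.succ)).symm
      (startVec hd x b.succ) i * (‖lastHidden hd x W b‖⁻¹ * lastHidden hd x W b j)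

/-- The direction of weights used for the lower bound. -/
noncomputable def testDir (hd : ∀ b, 1 ≤ d b) (x : EuclideanSpace ℝ (Fin (d 0)))
    (W : Params d k m) (b : Fin B) : Params d k m :=
  singleLayer ⟨b, Fin.last (k b + 1)⟩ (rankOneDir hd x W b)

theorem norm_testDir_le (hd : ∀ b, 1 ≤ d b) (x : EuclideanSpace ℝ (Fin (d 0)))
    (W : Params d k m) (b : Fin B) : ‖testDir hd x W b‖ ≤ 1 := by
  rw [← sq_le_one_iff₀ (norm_nonneg _), testDir, norm_sq_singleLayer]
  simp only [rankOneDir, Matrix.of_apply, mul_pow, ← Finset.mul_sum, ← Finset.sum_mul]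
  rw [← EuclideanSpace.real_norm_sq_eq, ← EuclideanSpace.real_norm_sq_eq,
    LinearIsometryEquiv.norm_map, norm_startVec_succ, ← mul_pow, one_pow, one_mul]
  -- Valid also for a vanishing hidden vector, whose inverse norm is zero by convention.
  exact pow_le_one₀ (by positivity) inv_mul_le_one

theorem matCLM_rankOneDir_lastHidden (hd : ∀ b, 1 ≤ d b) (x : EuclideanSpace ℝ (Fin (d 0)))
    (W : Params d k m) (b : Fin B) :
    matCLM (rankOneDir hd x W b) (lastHidden hd x W b) = ‖lastHidden hd x W b‖ •
      euclideanCast (layerWidth_last m (k b) (d b.castSucc) (d b.succ)).symm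
        (startVec hd x b.succ) := by
  ext i
  rw [matCLM_apply_apply]
  simp only [rankOneDir, Matrix.of_apply, PiLp.smul_apply, smul_eq_mul]
  simp only [mul_assoc, ← Finset.mul_sum, ← pow_two]
  rw [← EuclideanSpace.real_norm_sq_eq]
  rcases eq_or_ne ‖lastHidden hd x W b‖ 0 with h | h
  · simp [h]
  · field_simp

/-- The operator of a block after replacing its last layer by the rank-one perturbation. -/
noncomputable def testOp (hd : ∀ b, 1 ≤ d b) (x : EuclideanSpace ℝ (Fin (d 0)))
    (W : Params d k m) (b : Fin B) :
    EuclideanSpace ℝ (Fin (d b.castSucc)) →L[ℝ] EuclideanSpace ℝ (Fin (d b.succ)) :=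
  blockMap m (k b) (d b.castSucc) (d b.succ)
    (Function.update (blockLayersCLM d k m b W) (Fin.last (k b + 1))
      (matCLM (rankOneDir hd x W b)))

/-- The perturbation was chosen so that the block sends its start vector to a multiple of the next
start vector. The cascade of these operators therefore telescopes to a product of scalars. -/
theorem testOp_apply (hd : ∀ b, 1 ≤ d b) (x : EuclideanSpace ℝ (Fin (d 0)))
    (W : Params d k m) (b : Fin B) :
    testOp hd x W b (startVec hd x b.castSucc) =
      (blockScale m (k b) (d b.castSucc) (d b.succ) * ‖lastHidden hd x W b‖) •
        startVec hd x b.succ := by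
  rw [testOp, blockMap_apply]
  have h : chain (V := NodeSpace m (k b) (d b.castSucc) (d b.succ))
      (Function.update (blockLayersCLM d k m b W) (Fin.last (k b + 1))
      (matCLM (rankOneDir hd x W b))) (Fin.last (k b + 1)).succ
      (euclideanCast (layerWidth_zero m (k b) (d b.castSucc) (d b.succ)).symm
        (startVec hd x b.castSucc)) = ‖lastHidden hd x W b‖ •
      euclideanCast (layerWidth_last m (k b) (d b.castSucc) (d b.succ)).symm
        (startVec hd x b.succ) := by
    rw [chain_succ, Function.update_self, ContinuousLinearMap.comp_apply,
      chain_congr (A' := blockLayersCLM d k m b W)]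
    · exact matCLM_rankOneDir_lastHidden hd x W b
    · intro j hj
      rw [Function.update_of_ne]
      rintro rfl
      exact lt_irrefl _ hj
  refine (congrArg (fun y => blockScale m (k b) (d b.castSucc) (d b.succ) •
    euclideanCast (layerWidth_last m (k b) (d b.castSucc) (d b.succ)) y) h).trans ?_
  simp only [map_smul, smul_smul]
  congr 1

theorem chain_testOp (hd : ∀ b, 1 ≤ d b) (x : EuclideanSpace ℝ (Fin (d 0)))
    (W : Params d k m) (i : Fin (B + 1)) :
    chain (V := fun b => EuclideanSpace ℝ (Fin (d b))) (testOp hd x W) i x =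
      (∏ b : Fin B with b.castSucc < i,
        (blockScale m (k b) (d b.castSucc) (d b.succ) * ‖lastHidden hd x W b‖)) •
        startVec hd x i := by
  induction i using Fin.induction with
  | zero => simp [chain_zero, startVec]
  | succ i ih =>
    have h : (Finset.univ.filter fun j : Fin B => j.castSucc < i.succ) =
        insert i (Finset.univ.filter fun j : Fin B => j.castSucc < i.castSucc) := by
      ext j
      simp [Fin.castSucc_lt_succ_iff, le_iff_eq_or_lt]
    rw [chain_succ, ContinuousLinearMap.comp_apply, ih, map_smul, testOp_apply, h,
      Finset.prod_insert (by simp), smul_smul, mul_comm]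

theorem norm_outerMap_testOp (hB : 1 ≤ B) (hd : ∀ b, 1 ≤ d b)
    (x : EuclideanSpace ℝ (Fin (d 0))) (W : Params d k m) :
    ‖outerMap d x (testOp hd x W)‖ =
      ∏ b : Fin B, (blockScale m (k b) (d b.castSucc) (d b.succ) * ‖lastHidden hd x W b‖) := by
  have hlast : ‖startVec hd x (Fin.last B)‖ = 1 := by
    obtain ⟨n, rfl⟩ : ∃ n, B = n + 1 := ⟨B - 1, by omega⟩
    exact norm_startVec_succ hd x (Fin.last n)
  rw [outerMap_apply, chain_testOp,
    Finset.filter_true_of_mem (fun j _ => Fin.castSucc_lt_last j), norm_smul, hlast, mul_one,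
    Real.norm_eq_abs, abs_of_nonneg]
  exact Finset.prod_nonneg fun _ _ => mul_nonneg blockScale_nonneg (norm_nonneg _)

theorem blockLayersCLM_sum_testDir (hd : ∀ b, 1 ≤ d b) (x : EuclideanSpace ℝ (Fin (d 0)))
    (W : Params d k m) (t : Fin B → ℝ) (b : Fin B) :
    blockLayersCLM d k m b (∑ i, t i • testDir hd x W i) =
      t b • Pi.single (Fin.last (k b + 1)) (matCLM (rankOneDir hd x W b)) := by
  rw [map_sum, Finset.sum_eq_single b]
  · rw [map_smul, testDir, blockLayersCLM_singleLayer_self]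
  · intro b' _ hb'
    rw [map_smul, testDir, blockLayersCLM_singleLayer_of_ne hb'.symm]
    exact smul_zero (A := ∀ ℓ, LayerSpace m (k b) (d b.castSucc) (d b.succ) ℓ) (t b')
  · simp

/-- Only one layer per block moves, so by multilinearity each block operator is exactly affine in
its parameter `t b`. This is the form required by `le_norm_iteratedFDeriv_of_restrict`. -/
theorem bnn_add_sum_testDir (hd : ∀ b, 1 ≤ d b) (x : EuclideanSpace ℝ (Fin (d 0)))
    (W : Params d k m) (t : Fin B → ℝ) :
    bnn x (W + ∑ i, t i • testDir hd x W i) =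
      outerMap d x fun b => blockOps d k m W b + t b • testOp hd x W b := by
  rw [bnn_eq_outerMap]
  congr 1
  ext1 b
  rw [blockOps, map_add, blockLayersCLM_sum_testDir]
  have h : blockLayersCLM d k m b W +
      t b • (Pi.single (Fin.last (k b + 1)) (matCLM (rankOneDir hd x W b)) :
        ∀ ℓ, LayerSpace m (k b) (d b.castSucc) (d b.succ) ℓ) =
      Function.update (blockLayersCLM d k m b W) (Fin.last (k b + 1))
        (blockLayersCLM d k m b W (Fin.last (k b + 1)) +
          t b • matCLM (rankOneDir hd x W b)) := by
    ext1 j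
    rcases eq_or_ne j (Fin.last (k b + 1)) with rfl | h
    · simp
    · rw [Function.update_of_ne h, Pi.add_apply, Pi.smul_apply, Pi.single_eq_of_ne h, add_eq_left]
      exact smul_zero (A := LayerSpace m (k b) (d b.castSucc) (d b.succ) j) (t b)
  rw [h, ContinuousMultilinearMap.map_update_add, ContinuousMultilinearMap.map_update_smul,
    Function.update_eq_self]
  rfl

/-- The nodes of the blocks do not shrink: each hidden layer of each block multiplies the norm by
at least `ε √m`, on the inputs used for the lower bound. -/
def NodesGrow (hd : ∀ b, 1 ≤ d b) (x : EuclideanSpace ℝ (Fin (d 0))) (ε : ℝ)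
    (W : Params d k m) : Prop :=
  ∀ (b : Fin B) (ℓ : Fin (k b + 1)),
    ε * √(m : ℝ) * ‖blockNode W b (startVec hd x b.castSucc) ℓ.castSucc.castSucc‖ ≤
      ‖matCLM (weightMatrix W b ℓ.castSucc)
        (blockNode W b (startVec hd x b.castSucc) ℓ.castSucc.castSucc)‖

theorem NodesGrow.norm_lastHidden_ge {hd : ∀ b, 1 ≤ d b} {x : EuclideanSpace ℝ (Fin (d 0))}
    {ε : ℝ} (hε : 0 ≤ ε) {W : Params d k m} (h : NodesGrow hd x ε W) (b : Fin B) :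
    (ε * √(m : ℝ)) ^ (k b + 1) * ‖startVec hd x b.castSucc‖ ≤ ‖lastHidden hd x W b‖ := by
  have hind : ∀ i : Fin (k b + 2), (ε * √(m : ℝ)) ^ (i : ℕ) * ‖startVec hd x b.castSucc‖ ≤
      ‖blockNode W b (startVec hd x b.castSucc) i.castSucc‖ := by
    intro i
    induction i using Fin.induction with
    | zero =>
      rw [Fin.val_zero, pow_zero, one_mul]
      exact (norm_blockNode_zero W b (startVec hd x b.castSucc)).ge
    | succ i ih =>
      rw [← Fin.succ_castSucc, blockNode_succ]
      refine le_trans ?_ (h b i)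
      rw [Fin.val_succ, pow_succ', mul_assoc]
      exact mul_le_mul_of_nonneg_left ih (by positivity)
  exact hind (Fin.last (k b + 1))

theorem prod_norm_startVec (hB : 1 ≤ B) (hd : ∀ b, 1 ≤ d b) (x : EuclideanSpace ℝ (Fin (d 0))) :
    ∏ b : Fin B, ‖startVec hd x b.castSucc‖ = ‖x‖ := by
  obtain ⟨n, rfl⟩ : ∃ n, B = n + 1 := ⟨B - 1, by omega⟩
  rw [Fin.prod_univ_succ]
  have h : ∀ i : Fin n, ‖startVec hd x i.succ.castSucc‖ = 1 := by
    intro i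
    rw [← Fin.succ_castSucc]
    exact norm_startVec_succ hd x _
  simp only [h, Finset.prod_const_one, mul_one]
  rfl

/-- The growth `(ε √m) ^ (k b + 1)` over the hidden layers cancels the `k b + 1` factors `1 / √m` in
`blockScale`, leaving a constant independent of the width. -/
theorem NodesGrow.le_norm_outerMap_testOp (hB : 1 ≤ B) {hd : ∀ b, 1 ≤ d b}
    {x : EuclideanSpace ℝ (Fin (d 0))} (hm : 1 ≤ m)
    {ε : ℝ} (hε : 0 ≤ ε) {W : Params d k m} (h : NodesGrow hd x ε W) :
    (∏ b : Fin B, (1 / √(d b.castSucc : ℝ) * ε ^ (k b + 1))) * ‖x‖ ≤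
      ‖outerMap d x (testOp hd x W)‖ := by
  have hs : 0 < √(m : ℝ) := Real.sqrt_pos.2 (by exact_mod_cast hm)
  rw [norm_outerMap_testOp hB, ← prod_norm_startVec hB hd x, ← Finset.prod_mul_distrib]
  refine Finset.prod_le_prod (fun _ _ => by positivity) fun b _ => ?_
  refine le_trans (le_of_eq ?_)
    (mul_le_mul_of_nonneg_left (h.norm_lastHidden_ge hε b) blockScale_nonneg)
  rw [blockScale_eq, one_div (√(m : ℝ)), inv_pow, mul_pow]
  field_simp

/-- Any `G` that agrees with the network along the test directions is allowed, so the bound serves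
both the network and its version with linearized blocks. -/
theorem NodesGrow.le_norm_iteratedFDeriv {hd : ∀ b, 1 ≤ d b} {x : EuclideanSpace ℝ (Fin (d 0))}
    {W : Params d k m} {G : Params d k m → EuclideanSpace ℝ (Fin (d (Fin.last B)))}
    (hB : 1 ≤ B) (hm : 1 ≤ m) {ε : ℝ} (hε : 0 ≤ ε) (h : NodesGrow hd x ε W)
    (hG : ContDiff ℝ ∞ G)
    (hGW : ∀ t : Fin B → ℝ, G (W + ∑ i, t i • testDir hd x W i) =
      outerMap d x fun b => blockOps d k m W b + t b • testOp hd x W b) :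
    (∏ b : Fin B, (1 / √(d b.castSucc : ℝ) * ε ^ (k b + 1))) * ‖x‖ ≤
      ‖iteratedFDeriv ℝ B G W‖ :=
  (h.le_norm_outerMap_testOp hB hm hε).trans
    (le_norm_iteratedFDeriv_of_restrict (outerMap d x) hG W (testDir hd x W)
      (norm_testDir_le hd x W) _ _ hGW)

end LowerBound

/-! ### The network with linearized blocks -/

section Linearized

variable {B : ℕ} {d : Fin (B + 1) → ℕ} {k : Fin B → ℕ} {m : ℕ}

/-- The first-order expansion at `W₀` of the operator of a block. -/
noncomputable def linBlock (W₀ W : Params d k m) (b : Fin B) :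
    EuclideanSpace ℝ (Fin (d b.castSucc)) →L[ℝ] EuclideanSpace ℝ (Fin (d b.succ)) :=
  jet 1 (blockMap m (k b) (d b.castSucc) (d b.succ)) (blockLayersCLM d k m b W₀)
    (blockLayersCLM d k m b (W - W₀))

/-- The linear part of the first-order expansions of the blocks. -/
noncomputable def linBlockDeriv (W₀ : Params d k m) : Params d k m →L[ℝ] ∀ b : Fin B,
    EuclideanSpace ℝ (Fin (d b.castSucc)) →L[ℝ] EuclideanSpace ℝ (Fin (d b.succ)) :=
  ContinuousLinearMap.pi fun b =>
    (fderiv ℝ (blockMap m (k b) (d b.castSucc) (d b.succ)) (blockLayersCLM d k m b W₀)).comp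
      (blockLayersCLM d k m b)

/-- Separates a constant from a linear function of `W`, so that the results on multilinear maps
along affine maps apply. -/
theorem linBlock_eq (W₀ W : Params d k m) :
    linBlock W₀ W = (blockOps d k m W₀ - linBlockDeriv W₀ W₀) + linBlockDeriv W₀ W := by
  have h : linBlock W₀ W = blockOps d k m W₀ + linBlockDeriv W₀ (W - W₀) := by
    ext1 b
    rw [linBlock, jet_one]
    rfl
  rw [h, map_sub]
  abel

theorem fderiv_blockMap_single {k m din dout : ℕ} (A : ∀ ℓ, LayerSpace m k din dout ℓ)
    (ℓ : Fin (k + 2)) (N : LayerSpace m k din dout ℓ) :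
    fderiv ℝ (blockMap m k din dout) A (Pi.single ℓ N) =
      blockMap m k din dout (Function.update A ℓ N) := by
  rw [((blockMap m k din dout).hasFDerivAt A).fderiv, ContinuousMultilinearMap.linearDeriv_apply,
    Finset.sum_eq_single ℓ]
  · rw [Pi.single_eq_same]
  · intro j _ hj
    rw [Pi.single_eq_of_ne hj]
    exact (blockMap m k din dout).map_coord_zero j (Function.update_self _ _ _)
  · simp

/-- Linearizing a block loses nothing along the test directions, as these move a single layer of the
block. -/
theorem linBlock_add_sum_testDir (hd : ∀ b, 1 ≤ d b) (x : EuclideanSpace ℝ (Fin (d 0)))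
    (W : Params d k m) (t : Fin B → ℝ) (b : Fin B) :
    linBlock W (W + ∑ i, t i • testDir hd x W i) b =
      blockOps d k m W b + t b • testOp hd x W b := by
  rw [linBlock, jet_one, add_sub_cancel_left, blockLayersCLM_sum_testDir, map_smul,
    fderiv_blockMap_single]
  rfl

/-- The network in which each block is replaced by its first-order expansion at `W₀` is a
polynomial of degree `B`. -/
theorem NodesGrow.isPolynomialOfDegree_outerMap_linBlock {hd : ∀ b, 1 ≤ d b}
    {x : EuclideanSpace ℝ (Fin (d 0))} {W₀ : Params d k m} (hB : 1 ≤ B) (hm : 1 ≤ m) {ε : ℝ}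
    (hε : 0 < ε) (h : NodesGrow hd x ε W₀) (hx : x ≠ 0) :
    IsPolynomialOfDegree B fun W => outerMap d x (linBlock W₀ W) := by
  have hG : (fun W => outerMap d x (linBlock W₀ W)) = fun W => outerMap d x
      ((blockOps d k m W₀ - linBlockDeriv W₀ W₀) + linBlockDeriv W₀ W) := by
    ext1 W
    rw [linBlock_eq]
  have hsmooth : ContDiff ℝ ∞ (fun W => outerMap d x (linBlock W₀ W)) := by
    rw [hG]
    exact (outerMap d x).contDiff_comp_affine _ _
  refine ⟨hsmooth, fun W => ⟨?_, ?_⟩⟩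
  · have h1 : iteratedFDeriv ℝ B (fun W => outerMap d x (linBlock W₀ W)) W =
        iteratedFDeriv ℝ B (fun W => outerMap d x (linBlock W₀ W)) W₀ := by
      ext1 v
      rw [hG]
      simp only [ContinuousMultilinearMap.iteratedFDeriv_comp_affine,
        ContinuousMultilinearMap.compContinuousLinearMap_apply,
        ContinuousMultilinearMap.iteratedFDeriv_apply_eq_sum]
      refine Finset.sum_congr rfl fun e _ => ?_
      congr 1
      ext1 i
      -- An embedding of `Fin B` into itself is onto, so no slot keeps the base point and the
      -- derivative of order `B` is constant.
      have hi : i ∈ Set.range e :=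
        (Finite.injective_iff_surjective.1 e.injective) i
      rw [dif_pos hi, dif_pos hi]
    rw [h1]
    refine lt_of_lt_of_le ?_ (h.le_norm_iteratedFDeriv hB hm hε.le hsmooth fun t => ?_)
    · refine mul_pos (Finset.prod_pos fun b _ => mul_pos ?_ (pow_pos hε _)) (norm_pos_iff.2 hx)
      exact one_div_pos.2 (Real.sqrt_pos.2 (by exact_mod_cast hd _))
    · congr 1
      ext1 b
      exact linBlock_add_sum_testDir hd x W₀ t b
  · rw [hG, (outerMap d x).iteratedFDeriv_comp_affine_eq_zero _ _ (by simp), norm_zero]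

theorem isAffineInCoords_outerMap_linBlock (x : EuclideanSpace ℝ (Fin (d 0)))
    (W₀ : Params d k m) (b : Fin B) :
    IsAffineInCoords {i : WeightIdx d k m | i.1.1 = b}
      (fun W => outerMap d x (linBlock W₀ W)) := by
  intro U V hUV t
  have h : linBlock W₀ ((1 - t) • U + t • V) =
      (1 - t) • linBlock W₀ U + t • linBlock W₀ V := by
    simp only [linBlock_eq, map_add, map_smul]
    module
  simp only [h]
  refine (outerMap d x).map_lineMap_of_eq_off b _ _ (fun b' hb' => ?_) t
  rw [linBlock, linBlock]
  congr 1
  ext1 ℓ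
  rw [blockLayersCLM_apply, blockLayersCLM_apply, weightMatrix_congr]
  intro i hi
  have hib : i ∉ {i : WeightIdx d k m | i.1.1 = b} := fun hib =>
    hb' ((congrArg Sigma.fst hi).symm.trans hib)
  simp [hUV i hib]

theorem norm_blockLayersCLM_le (b : Fin B) (W : Params d k m) :
    ‖blockLayersCLM d k m b W‖ ≤ ‖layersCLM d k m W‖ := by
  rw [pi_norm_le_iff_of_nonneg (norm_nonneg _)]
  exact fun ℓ => norm_le_pi_norm (layersCLM d k m W) ⟨b, ℓ⟩

/-- The same count of powers for one block: `k + 1` factors `1 / √m` against `k + 1 - n` slots of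
size `√m`. The case `n = 0` shows that a block varies by `O(1)`; the case `n = 1` makes its
quadratic remainder `O(1 / √m)`. -/
theorem norm_blockMap_add_sub_jet_le {k m din dout : ℕ} (hdin : 1 ≤ din) (hm : 1 ≤ m) {n : ℕ}
    (hn : n ≤ 1) (A v : ∀ ℓ, LayerSpace m k din dout ℓ) {K R : ℝ} (hK : 0 ≤ K) (hR : 0 ≤ R)
    (hA : ‖A‖ ≤ K * √(m : ℝ)) (hv : ‖v‖ ≤ R) :
    ‖blockMap m k din dout (A + v) - jet n (blockMap m k din dout) A v‖ ≤
      (k + 2).descFactorial (n + 1) * (K + R) ^ (k + 1 - n) * R ^ (n + 1) / √(m : ℝ) ^ n := by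
  have h1 : 1 ≤ √(m : ℝ) := Real.one_le_sqrt.2 (by exact_mod_cast hm)
  refine ((blockMap m k din dout).norm_map_add_sub_jet_le n A v hA hv).trans ?_
  have hf := (norm_blockMap_le (m := m) (k := k) (din := din) (dout := dout)).trans
    (blockScale_le hdin)
  have hexp : k + 2 - (n + 1) = k + 1 - n := by omega
  rw [Fintype.card_fin, hexp]
  calc _ ≤ ((k + 2).descFactorial (n + 1) : ℝ) * (1 / √(m : ℝ)) ^ (k + 1) *
        ((K + R) * √(m : ℝ)) ^ (k + 1 - n) * R ^ (n + 1) := by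
        gcongr
        nlinarith
    _ = _ := by
        have hs : √(m : ℝ) ^ (k + 1) = √(m : ℝ) ^ (k + 1 - n) * √(m : ℝ) ^ n := by
          rw [← pow_add]; congr 1; omega
        rw [one_div, inv_pow, mul_pow, hs]
        field_simp

/-- The error of the linearization of the blocks. -/
theorem norm_bnn_sub_outerMap_linBlock_le (hd : ∀ b, 1 ≤ d b)
    (x : EuclideanSpace ℝ (Fin (d 0))) (hm : 1 ≤ m) {K R T E₁ E₂ : ℝ} (hK : 0 ≤ K) (hR : 0 ≤ R)
    (hE₁ : ∀ b, ((k b + 2).descFactorial 1 : ℝ) * (K + R) ^ (k b + 1) * R ≤ E₁)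
    (hE₂ : ∀ b, ((k b + 2).descFactorial 2 : ℝ) * (K + R) ^ (k b) * R ^ 2 ≤ E₂)
    (hT0 : 0 ≤ T) (hE₁0 : 0 ≤ E₁) (hE₂0 : 0 ≤ E₂) {W₀ W : Params d k m}
    (hW₀ : ‖layersCLM d k m W₀‖ ≤ K * √(m : ℝ)) (hT : ∀ b, ‖blockOps d k m W₀ b‖ ≤ T)
    (hW : W ∈ weightBall W₀ R) :
    ‖bnn x W - outerMap d x (linBlock W₀ W)‖ ≤
      B * (T + E₁ + E₂) ^ (B - 1) * E₂ * ‖x‖ / √(m : ℝ) := by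
  have h1 : 1 ≤ √(m : ℝ) := Real.one_le_sqrt.2 (by exact_mod_cast hm)
  have hsplit : ∀ b, blockLayersCLM d k m b W =
      blockLayersCLM d k m b W₀ + blockLayersCLM d k m b (W - W₀) := by
    intro b
    rw [← map_add]; simp
  have hA : ∀ b, ‖blockLayersCLM d k m b W₀‖ ≤ K * √(m : ℝ) :=
    fun b => (norm_blockLayersCLM_le b W₀).trans hW₀
  have hv : ∀ b, ‖blockLayersCLM d k m b (W - W₀)‖ ≤ R :=
    fun b => (norm_blockLayersCLM_le b _).trans (norm_layersCLM_sub_le hR hW)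
  have hfirst : ∀ b, ‖blockOps d k m W b - blockOps d k m W₀ b‖ ≤ E₁ := by
    intro b
    have h := norm_blockMap_add_sub_jet_le (dout := d b.succ) (hd b.castSucc) hm zero_le_one
      _ _ hK hR (hA b) (hv b)
    rw [← hsplit] at h
    have hjet : jet 0 (blockMap m (k b) (d b.castSucc) (d b.succ)) (blockLayersCLM d k m b W₀)
        (blockLayersCLM d k m b (W - W₀)) = blockOps d k m W₀ b := by
      simp [jet, blockOps]
    rw [hjet] at h
    refine h.trans (le_trans (le_of_eq ?_) (hE₁ b))
    simp
  have hquad : ∀ b, ‖blockOps d k m W b - linBlock W₀ W b‖ ≤ E₂ / √(m : ℝ) := by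
    intro b
    have h := norm_blockMap_add_sub_jet_le (dout := d b.succ) (hd b.castSucc) hm le_rfl
      _ _ hK hR (hA b) (hv b)
    rw [← hsplit] at h
    refine h.trans ?_
    rw [pow_one]
    gcongr
    exact hE₂ b
  have hF : ‖blockOps d k m W‖ ≤ T + E₁ + E₂ := by
    rw [pi_norm_le_iff_of_nonneg (by positivity)]
    intro b
    have := norm_le_insert' (blockOps d k m W b) (blockOps d k m W₀ b)
    linarith [hfirst b, hT b]
  have hE₂m : E₂ / √(m : ℝ) ≤ E₂ := div_le_self hE₂0 h1
  have hL : ‖linBlock W₀ W‖ ≤ T + E₁ + E₂ := by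
    rw [pi_norm_le_iff_of_nonneg (by positivity)]
    intro b
    have h2 := norm_le_insert' (blockOps d k m W b) (blockOps d k m W₀ b)
    have h3 := norm_le_insert (blockOps d k m W b) (linBlock W₀ W b)
    linarith [hfirst b, hT b, hquad b]
  have hdiff : ‖blockOps d k m W - linBlock W₀ W‖ ≤ E₂ / √(m : ℝ) := by
    rw [pi_norm_le_iff_of_nonneg (by positivity)]
    exact hquad
  rw [bnn_eq_outerMap]
  -- A multilinear map is Lipschitz on bounded sets; both tuples of block operators have norm at
  -- most `T + E₁ + E₂`.
  refine ((outerMap d x).norm_image_sub_le _ _).trans ?_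
  rw [Fintype.card_fin]
  calc _ ≤ ‖x‖ * B * (T + E₁ + E₂) ^ (B - 1) * (E₂ / √(m : ℝ)) := by
        gcongr
        · exact norm_outerMap_le x
        · exact max_le hF hL
    _ = _ := by ring

end Linearized

/-! ### Product measures -/

section ProductMeasure

variable {ι κ α : Type*} [Fintype ι] [Fintype κ] [MeasurableSpace α]

/-- Resampling the coordinates in `s` preserves a product of probability measures. -/
theorem measurePreserving_piecewise (γ : Measure α) [IsProbabilityMeasure γ] (s : Set ι)
    [DecidablePred (· ∈ s)] :
    MeasurePreserving (fun q : (ι → α) × (ι → α) => s.piecewise q.2 q.1)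
      ((Measure.pi fun _ => γ).prod (Measure.pi fun _ => γ)) (Measure.pi fun _ => γ) := by
  have hmeas : Measurable (fun q : (ι → α) × (ι → α) => s.piecewise q.2 q.1) := by
    refine measurable_pi_lambda _ fun i => ?_
    by_cases h : i ∈ s
    · simp only [Set.piecewise_eq_of_mem _ _ _ h]; fun_prop
    · simp only [Set.piecewise_eq_of_notMem _ _ _ h]; fun_prop
  refine ⟨hmeas, (Measure.pi_eq fun t ht => ?_).symm⟩
  rw [Measure.map_apply hmeas (MeasurableSet.univ_pi ht)]
  -- The preimage of a box is a product of two boxes: coordinates in `s` constrain the second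
  -- sample, the others the first.
  have hpre : (fun q : (ι → α) × (ι → α) => s.piecewise q.2 q.1) ⁻¹' Set.univ.pi t =
      (Set.univ.pi fun i => if i ∈ s then Set.univ else t i) ×ˢ
        (Set.univ.pi fun i => if i ∈ s then t i else Set.univ) := by
    ext q
    simp only [Set.mem_preimage, Set.mem_prod, Set.mem_univ_pi, ← forall_and]
    refine forall_congr' fun i => ?_
    by_cases h : i ∈ s <;> simp [h]
  rw [hpre, Measure.prod_prod, Measure.pi_pi, Measure.pi_pi, ← Finset.prod_mul_distrib]
  refine Finset.prod_congr rfl fun i _ => ?_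
  by_cases h : i ∈ s <;> simp [h]

/-- Fubini after resampling `s`. It replaces conditioning on the coordinates outside `s`, which stay
frozen at `w`. -/
theorem pi_le_of_forall_piecewise (γ : Measure α) [IsProbabilityMeasure γ] (s : Set ι)
    [DecidablePred (· ∈ s)] {E : Set (ι → α)} (hE : MeasurableSet E) (ε : ENNReal)
    (h : ∀ w, (Measure.pi fun _ => γ) {w' | s.piecewise w' w ∈ E} ≤ ε) :
    (Measure.pi fun _ => γ) E ≤ ε := by
  have hp := measurePreserving_piecewise γ s
  rw [← hp.measure_preimage hE.nullMeasurableSet, Measure.prod_apply (hp.measurable hE)]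
  calc _ ≤ ∫⁻ _w, ε ∂(Measure.pi fun _ : ι => γ) := lintegral_mono fun w => h w
    _ = ε := by simp

/-- Coordinates along an injection. -/
theorem measurePreserving_comp_injective (γ : Measure α) [IsProbabilityMeasure γ] {f : κ → ι}
    (hf : Function.Injective f) :
    MeasurePreserving (fun w : ι → α => w ∘ f) (Measure.pi fun _ => γ)
      (Measure.pi fun _ => γ) := by
  refine ⟨by fun_prop, ?_⟩
  have h : iIndepFun (fun (i : ι) (w : ι → α) => w i) (Measure.pi fun _ : ι => γ) :=
    iIndepFun_pi (X := fun _ x => x) fun _ => aemeasurable_id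
  have h2 := (h.precomp hf).map_fun_eq_pi_map fun i => (measurable_pi_apply (f i)).aemeasurable
  refine h2.trans ?_
  congr 1
  ext1 i
  exact (measurePreserving_eval (fun _ : ι => γ) (f i)).map_eq

end ProductMeasure

/-! ### Gaussian vectors and matrices -/

section Gaussian

/-- The law of a linear form in independent standard normal variables. -/
theorem map_linearForm_gaussian {κ : Type*} [Fintype κ] (c : κ → ℝ) (hc : ∑ j, c j ^ 2 = 1) :
    (Measure.pi fun _ : κ => gaussianReal 0 1).map (fun w => ∑ j, w j * c j) =
      gaussianReal 0 1 := by
  apply Measure.ext_of_charFun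
  ext t
  have h : iIndepFun (fun (j : κ) (w : κ → ℝ) => w j * c j)
      (Measure.pi fun _ : κ => gaussianReal 0 1) :=
    iIndepFun_pi (X := fun j x => x * c j) fun _ => by fun_prop
  rw [h.charFun_map_fun_sum_eq_prod fun j => Measurable.aemeasurable (by fun_prop), Finset.prod_apply]
  have h1 : ∀ j, (Measure.pi fun _ : κ => gaussianReal 0 1).map (fun w : κ → ℝ => w j * c j) =
      gaussianReal 0 (.mk (c j ^ 2) (sq_nonneg _)) := by
    intro j
    have h2 := (measurePreserving_eval (fun _ : κ => gaussianReal 0 1) j).map_eq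
    rw [show (fun w : κ → ℝ => w j * c j) = (fun x => x * c j) ∘ Function.eval j from rfl,
      ← Measure.map_map (by fun_prop) (by fun_prop), h2, gaussianReal_map_mul_const]
    simp
  simp only [h1, charFun_gaussianReal]
  rw [← Complex.exp_sum]
  congr 1
  have h3 : (∑ j, ((c j : ℂ)) ^ 2) = 1 := by exact_mod_cast hc
  simp only [Complex.ofReal_zero, mul_zero, zero_mul, zero_sub, NNReal.coe_mk,
    Complex.ofReal_pow, Finset.sum_neg_distrib]
  rw [← Finset.sum_div, ← Finset.sum_mul, h3]
  simp

theorem gaussianReal_ge_le {t : ℝ} (ht : 0 ≤ t) :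
    gaussianReal 0 1 {s | t ≤ s} ≤ ENNReal.ofReal (Real.exp (-t ^ 2 / 2)) := by
  have h : HasSubgaussianMGF id 1 (gaussianReal 0 1) := by
    refine ⟨fun t => ?_, fun t => ?_⟩
    · exact integrable_exp_mul_gaussianReal t
    · rw [mgf_id_gaussianReal]; simp
  have := h.measure_ge_le ht
  rw [← ofReal_measureReal]
  refine ENNReal.ofReal_le_ofReal (this.trans (le_of_eq ?_))
  simp

/-- A linear form with coefficient vector of norm at most one has Gaussian tails. -/
theorem pi_gaussian_linearForm_ge_le {κ : Type*} [Fintype κ] (c : κ → ℝ) (hc : ∑ j, c j ^ 2 ≤ 1)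
    {t : ℝ} (ht : 0 ≤ t) :
    (Measure.pi fun _ : κ => gaussianReal 0 1) {w | t < ∑ j, w j * c j} ≤
      ENNReal.ofReal (Real.exp (-t ^ 2 / 2)) := by
  set r := √(∑ j, c j ^ 2) with hr
  have hr0 : 0 ≤ ∑ j, c j ^ 2 := Finset.sum_nonneg fun _ _ => sq_nonneg _
  rcases eq_or_lt_of_le (Real.sqrt_nonneg (∑ j, c j ^ 2)) with h0 | h0
  -- For zero coefficients no normalization is possible, but the strict inequality makes the event
  -- empty.
  · have hz : ∀ j, c j = 0 := by
      intro j
      have h1 : ∑ j, c j ^ 2 = 0 := (Real.sqrt_eq_zero hr0).1 h0.symm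
      rw [Finset.sum_eq_zero_iff_of_nonneg fun _ _ => sq_nonneg _] at h1
      exact pow_eq_zero_iff two_ne_zero |>.1 (h1 j (Finset.mem_univ j))
    have he : {w : κ → ℝ | t < ∑ j, w j * c j} = ∅ := by
      ext w; simp [hz, ht]
    rw [he, measure_empty]
    exact zero_le
  · have hr1 : r ≤ 1 := Real.sqrt_le_one.2 hc
    have hunit : ∑ j, (c j / r) ^ 2 = 1 := by
      simp only [div_pow]
      rw [← Finset.sum_div, hr, Real.sq_sqrt hr0, div_self]
      exact (Real.sqrt_pos.1 h0).ne'
    calc _ ≤ (Measure.pi fun _ : κ => gaussianReal 0 1)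
          ((fun w => ∑ j, w j * (c j / r)) ⁻¹' {s | t ≤ s}) := by
          refine measure_mono fun w hw => ?_
          have hw' : t < ∑ j, w j * c j := hw
          have h2 : ∑ j, w j * (c j / r) = (∑ j, w j * c j) / r := by
            rw [Finset.sum_div]
            exact Finset.sum_congr rfl fun j _ => by ring
          change t ≤ ∑ j, w j * (c j / r)
          rw [h2, le_div_iff₀ h0]
          nlinarith
      _ = gaussianReal 0 1 {s | t ≤ s} := by
          conv_rhs => rw [← map_linearForm_gaussian _ hunit]
          exact (Measure.map_apply (by fun_prop) measurableSet_Ici).symm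
      _ ≤ _ := gaussianReal_ge_le ht

/-- The exponential moment of minus the square of a standard normal variable is below one. -/
theorem exists_lintegral_exp_neg_sq_gaussian_le : ∃ ε : ℝ, 0 < ε ∧
    ∫⁻ s, ENNReal.ofReal (Real.exp (-s ^ 2)) ∂(gaussianReal 0 1) ≤
      ENNReal.ofReal (Real.exp (-(2 * ε))) := by
  have hint : Integrable (fun s : ℝ => Real.exp (-s ^ 2)) (gaussianReal 0 1) := by
    refine Integrable.of_bound (by fun_prop) 1 (ae_of_all _ fun s => ?_)
    rw [Real.norm_eq_abs, Real.abs_exp]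
    exact Real.exp_le_one_iff.2 (by nlinarith [sq_nonneg s])
  have hlt : ∫ s, Real.exp (-s ^ 2) ∂(gaussianReal 0 1) < 1 := by
    -- The integrand is nonnegative and vanishes only at zero, a null set for the Gaussian law.
    have hpos : 0 < ∫ s, (1 - Real.exp (-s ^ 2)) ∂(gaussianReal 0 1) := by
      refine (integral_pos_iff_support_of_nonneg (f := fun s : ℝ => 1 - Real.exp (-s ^ 2)) ?_
        ((integrable_const (1 : ℝ)).sub hint)).2 ?_
      rotate_left
      · have hsupp : Function.support (fun s : ℝ => 1 - Real.exp (-s ^ 2)) = {0}ᶜ := by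
          ext s
          simp only [Function.mem_support, ne_eq, Set.mem_compl_iff, Set.mem_singleton_iff,
            sub_eq_zero, eq_comm (a := (1 : ℝ)), Real.exp_eq_one_iff]
          simp
        have := nullSingletonClass_gaussianReal (μ := 0) (v := 1) one_ne_zero
        rw [hsupp, prob_compl_eq_one_sub (measurableSet_singleton _), measure_singleton]
        simp
      · intro s
        have : Real.exp (-s ^ 2) ≤ 1 := Real.exp_le_one_iff.2 (by nlinarith [sq_nonneg s])
        simpa using this
    rw [integral_sub (integrable_const _) hint] at hpos
    simpa using hpos
  have hpos : 0 < ∫ s, Real.exp (-s ^ 2) ∂(gaussianReal 0 1) := by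
    rw [integral_pos_iff_support_of_nonneg (fun s => (Real.exp_pos _).le) hint]
    have : Function.support (fun s : ℝ => Real.exp (-s ^ 2)) = Set.univ := by
      ext s; simp [Real.exp_ne_zero]
    rw [this]
    simp
  -- This `ε` makes `exp (-(2 * ε))` equal to the moment.
  refine ⟨-Real.log (∫ s, Real.exp (-s ^ 2) ∂(gaussianReal 0 1)) / 2, ?_, ?_⟩
  · have := Real.log_neg hpos hlt
    linarith
  · rw [← ofReal_integral_eq_lintegral_ofReal hint (ae_of_all _ fun s => (Real.exp_pos _).le)]
    refine ENNReal.ofReal_le_ofReal (le_of_eq ?_)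
    rw [show -(2 * (-Real.log (∫ s, Real.exp (-s ^ 2) ∂(gaussianReal 0 1)) / 2)) =
      Real.log (∫ s, Real.exp (-s ^ 2) ∂(gaussianReal 0 1)) by ring, Real.exp_log hpos]

/-- Lower tail of the norm of a standard Gaussian vector. -/
theorem pi_gaussian_sum_sq_lt_le {ε : ℝ}
    (hε : ∫⁻ s, ENNReal.ofReal (Real.exp (-s ^ 2)) ∂(gaussianReal 0 1) ≤
      ENNReal.ofReal (Real.exp (-(2 * ε)))) (n : ℕ) :
    (Measure.pi fun _ : Fin n => gaussianReal 0 1) {s | ∑ i, s i ^ 2 < ε * n} ≤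
      ENNReal.ofReal (Real.exp (-(ε * n))) := by
  set μ := Measure.pi fun _ : Fin n => gaussianReal 0 1
  have hind : iIndepFun (fun (i : Fin n) (s : Fin n → ℝ) =>
      ENNReal.ofReal (Real.exp (-(s i) ^ 2))) μ :=
    iIndepFun_pi (X := fun _ x => ENNReal.ofReal (Real.exp (-x ^ 2))) fun _ => by fun_prop
  have hprod := lintegral_prod_eq_prod_lintegral_of_indepFun Finset.univ _ hind
    fun i => by fun_prop
  have hone : ∀ i : Fin n, ∫⁻ s, ENNReal.ofReal (Real.exp (-(s i) ^ 2)) ∂μ ≤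
      ENNReal.ofReal (Real.exp (-(2 * ε))) := by
    intro i
    refine le_trans (le_of_eq ?_) hε
    exact (measurePreserving_eval (fun _ : Fin n => gaussianReal 0 1) i).lintegral_comp
      (f := fun s => ENNReal.ofReal (Real.exp (-s ^ 2))) (by fun_prop)
  have hmoment : ∫⁻ s, ∏ i, ENNReal.ofReal (Real.exp (-(s i) ^ 2)) ∂μ ≤
      ENNReal.ofReal (Real.exp (-(2 * ε * n))) := by
    rw [hprod]
    refine (Finset.prod_le_prod' fun i _ => hone i).trans (le_of_eq ?_)
    rw [Finset.prod_const, Finset.card_univ, Fintype.card_fin,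
      ← ENNReal.ofReal_pow (Real.exp_pos _).le, ← Real.exp_nat_mul]
    congr 2
    ring
  -- Markov's inequality for `exp (-∑ i, s i ^ 2)`: the moment is at most `exp (-2εn)` by
  -- independence, the threshold is `exp (-εn)`, and their quotient is the bound.
  calc μ {s | ∑ i, s i ^ 2 < ε * n}
      ≤ μ {s | ENNReal.ofReal (Real.exp (-(ε * n))) ≤
          ∏ i, ENNReal.ofReal (Real.exp (-(s i) ^ 2))} := by
        refine measure_mono fun s hs => ?_
        have hs' : ∑ i, s i ^ 2 < ε * n := hs
        change _ ≤ ∏ i, ENNReal.ofReal (Real.exp (-(s i) ^ 2))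
        rw [← ENNReal.ofReal_prod_of_nonneg fun _ _ => (Real.exp_pos _).le, ← Real.exp_sum]
        refine ENNReal.ofReal_le_ofReal (Real.exp_le_exp.2 ?_)
        rw [Finset.sum_neg_distrib]
        linarith
    _ ≤ (∫⁻ s, ∏ i, ENNReal.ofReal (Real.exp (-(s i) ^ 2)) ∂μ) /
          ENNReal.ofReal (Real.exp (-(ε * n))) :=
        meas_ge_le_lintegral_div (Measurable.aemeasurable (by fun_prop))
          (by simpa using Real.exp_pos _) ENNReal.ofReal_ne_top
    _ ≤ ENNReal.ofReal (Real.exp (-(2 * ε * n))) / ENNReal.ofReal (Real.exp (-(ε * n))) := by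
        gcongr
    _ = _ := by
        rw [← ENNReal.ofReal_div_of_pos (Real.exp_pos _), ← Real.exp_sub]
        congr 2
        ring

/-- The image of a unit vector under a standard Gaussian matrix is a standard Gaussian vector. -/
theorem map_mulVec_gaussian {a b : ℕ} (h : Fin b → ℝ) (hh : ∑ j, h j ^ 2 = 1) :
    (Measure.pi fun _ : Fin a × Fin b => gaussianReal 0 1).map
      (fun y i => ∑ j, y (i, j) * h j) = Measure.pi fun _ : Fin a => gaussianReal 0 1 := by
  -- The matrix is a product of independent rows, and each row is then mapped to its own linear
  -- form.
  have hcurry : (Measure.pi fun _ : Fin a × Fin b => gaussianReal 0 1).map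
      (MeasurableEquiv.curry (Fin a) (Fin b) ℝ) =
      Measure.pi fun _ : Fin a => Measure.pi fun _ : Fin b => gaussianReal 0 1 := by
    have := Measure.infinitePi_map_curry (X := ℝ) (ι := Fin a) (κ := Fin b)
      (fun _ _ => gaussianReal 0 1)
    simpa only [Measure.infinitePi_eq_pi] using this
  have hrow := Measure.pi_map_pi (ι := Fin a)
    (μ := fun _ => Measure.pi fun _ : Fin b => gaussianReal 0 1)
    (f := fun _ (w : Fin b → ℝ) => ∑ j, w j * h j)
    (hμ := fun _ => by rw [map_linearForm_gaussian h hh]; infer_instance)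
    fun _ => Measurable.aemeasurable (by fun_prop)
  simp only [map_linearForm_gaussian h hh] at hrow
  rw [← hrow, ← hcurry, Measure.map_map (by fun_prop) (MeasurableEquiv.measurable _)]
  rfl

end Gaussian

/-! ### Norms of Gaussian matrices -/

section GaussianMatrix

/-- A 1-separated subset of the ball of radius 2 has at most `5 ^ dim` points. One of maximal
cardinality comes within distance less than 1 of every point of that ball, since such a point could
otherwise be added. Scaling by one half gives the net of the unit ball. -/
theorem exists_finset_net (E : Type*) [NormedAddCommGroup E] [NormedSpace ℝ E]
    [FiniteDimensional ℝ E] : ∃ s : Finset E, s.card ≤ 5 ^ Module.finrank ℝ E ∧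
      (∀ u ∈ s, ‖u‖ ≤ 1) ∧ ∀ v : E, ‖v‖ ≤ 1 → ∃ u ∈ s, ‖v - u‖ ≤ 1 / 2 := by
  classical
  let S : Set ℕ := {n | ∃ s : Finset E, s.card = n ∧ (∀ c ∈ s, ‖c‖ ≤ 2) ∧
    ∀ c ∈ s, ∀ d ∈ s, c ≠ d → 1 ≤ ‖c - d‖}
  have hbdd : BddAbove S := by
    refine ⟨5 ^ Module.finrank ℝ E, ?_⟩
    rintro n ⟨s, rfl, h2, h1⟩
    exact Besicovitch.card_le_of_separated s h2 h1
  have hne : S.Nonempty := ⟨0, ∅, by simp⟩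
  obtain ⟨s, hcard, h2, h1⟩ := Nat.sSup_mem hne hbdd
  have hhalf : ∀ u : E, ‖(1 / 2 : ℝ) • u‖ = 1 / 2 * ‖u‖ := fun u => by
    rw [norm_smul]; norm_num
  refine ⟨s.image fun u => (1 / 2 : ℝ) • u, ?_, ?_, ?_⟩
  · exact Finset.card_image_le.trans (Besicovitch.card_le_of_separated s h2 h1)
  · intro u hu
    obtain ⟨c, hc, rfl⟩ := Finset.mem_image.1 hu
    rw [hhalf]
    linarith [h2 c hc]
  · intro v hv
    by_contra! hfar
    have hsep : ∀ c ∈ s, 1 ≤ ‖(2 : ℝ) • v - c‖ := by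
      intro c hc
      have h := hfar _ (Finset.mem_image_of_mem _ hc)
      have he : v - (1 / 2 : ℝ) • c = (1 / 2 : ℝ) • ((2 : ℝ) • v - c) := by
        rw [smul_sub, smul_smul]; norm_num
      rw [he, hhalf] at h
      linarith
    have hv2 : (2 : ℝ) • v ∉ s := fun hmem => by
      have := hsep _ hmem
      rw [sub_self, norm_zero] at this
      linarith
    have hmem : (insert ((2 : ℝ) • v) s).card ∈ S := by
      refine ⟨_, rfl, ?_, ?_⟩
      · intro c hc
        rcases Finset.mem_insert.1 hc with rfl | hc
        · rw [norm_smul, Real.norm_two]; linarith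
        · exact h2 c hc
      · intro c hc d hd hcd
        rcases Finset.mem_insert.1 hc with rfl | hc <;> rcases Finset.mem_insert.1 hd with rfl | hd
        · exact absurd rfl hcd
        · exact hsep d hd
        · rw [norm_sub_rev]; exact hsep c hc
        · exact h1 c hc d hd hcd
    have hle := le_csSup hbdd hmem
    rw [Finset.card_insert_of_notMem hv2, ← hcard] at hle
    omega

/-- The norm of an operator is controlled by its bilinear form on nets of the unit balls. -/
theorem opNorm_le_of_nets {E F : Type*} [NormedAddCommGroup E] [NormedSpace ℝ E]
    [NormedAddCommGroup F] [InnerProductSpace ℝ F] (A : E →L[ℝ] F) {N : Finset E} {N' : Finset F}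
    (hN : ∀ v : E, ‖v‖ ≤ 1 → ∃ u ∈ N, ‖v - u‖ ≤ 1 / 2)
    (hN' : ∀ v : F, ‖v‖ ≤ 1 → ∃ u ∈ N', ‖v - u‖ ≤ 1 / 2) {t : ℝ} (ht : 0 ≤ t)
    (h : ∀ u ∈ N', ∀ v ∈ N, inner ℝ u (A v) ≤ t) : ‖A‖ ≤ 4 * t := by
  have h1 : ∀ v ∈ N, ‖A v‖ ≤ 2 * t := by
    intro v hv
    rcases eq_or_ne (A v) 0 with h0 | h0
    · rw [h0, norm_zero]; linarith
    · have hpos : 0 < ‖A v‖ := norm_pos_iff.2 h0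
      obtain ⟨u, hu, hwu⟩ := hN' (‖A v‖⁻¹ • A v) (by
        rw [norm_smul, norm_inv, norm_norm, inv_mul_cancel₀ hpos.ne'])
      have h2 : inner ℝ (‖A v‖⁻¹ • A v) (A v) = ‖A v‖ := by
        rw [real_inner_smul_left, real_inner_self_eq_norm_sq]
        field_simp
      have h3 : inner ℝ (‖A v‖⁻¹ • A v - u) (A v) ≤ 1 / 2 * ‖A v‖ :=
        (real_inner_le_norm _ _).trans (by gcongr)
      rw [inner_sub_left, h2] at h3
      linarith [h u hu v hv]
  -- Each net costs a factor of two: the approximation error is half of the norm being estimated and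
  -- is absorbed on the left.
  have h2 : ‖A‖ ≤ 2 * t + 1 / 2 * ‖A‖ := by
    refine A.opNorm_le_of_unit_norm (by positivity) fun v hv => ?_
    obtain ⟨u, hu, hvu⟩ := hN v hv.le
    have h3 : A v = A u + A (v - u) := by rw [← map_add]; simp
    rw [h3]
    refine (norm_add_le _ _).trans (add_le_add (h1 u hu) ?_)
    refine (A.le_opNorm _).trans ?_
    rw [mul_comm]
    gcongr
  linarith

variable {a b : ℕ}

theorem inner_matCLM_of (y : Fin a × Fin b → ℝ) (u : EuclideanSpace ℝ (Fin a))
    (v : EuclideanSpace ℝ (Fin b)) :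
    inner ℝ u (matCLM (Matrix.of fun i j => y (i, j)) v) = ∑ q, y q * (u q.1 * v q.2) := by
  rw [PiLp.inner_apply, Fintype.sum_prod_type]
  refine Finset.sum_congr rfl fun i _ => ?_
  rw [matCLM_apply_apply, real_inner_comm]
  simp only [RCLike.inner_apply, conj_trivial, Matrix.of_apply, Finset.mul_sum]
  exact Finset.sum_congr rfl fun j _ => by ring

/-- The operator norm of a Gaussian matrix. -/
theorem pi_gaussian_opNorm_gt_le {m : ℕ} (ha : a ≤ m) (hb : b ≤ m) :
    (Measure.pi fun _ : Fin a × Fin b => gaussianReal 0 1)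
      {y | 16 * √(m : ℝ) < ‖matCLM (Matrix.of fun i j => y (i, j))‖} ≤
      ENNReal.ofReal (Real.exp (-(4 * m))) := by
  obtain ⟨N, hNcard, hN1, hN⟩ := exists_finset_net (EuclideanSpace ℝ (Fin b))
  obtain ⟨N', hNcard', hN1', hN'⟩ := exists_finset_net (EuclideanSpace ℝ (Fin a))
  rw [finrank_euclideanSpace_fin] at hNcard hNcard'
  set μ := Measure.pi fun _ : Fin a × Fin b => gaussianReal 0 1
  -- The threshold `16 √m` is four times `4 √m`, the factor four coming from the nets. Each pair
  -- exceeds `4 √m` with probability at most `exp (-8m)`, and there are at most `25 ^ m ≤ exp (4m)`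
  -- pairs.
  have hsub : {y : Fin a × Fin b → ℝ |
      16 * √(m : ℝ) < ‖matCLM (Matrix.of fun i j => y (i, j))‖} ⊆
      ⋃ q ∈ N' ×ˢ N, {y | 4 * √(m : ℝ) < ∑ p, y p * (q.1 p.1 * q.2 p.2)} := by
    intro y hy
    by_contra hcon
    simp only [Set.mem_iUnion, Set.mem_ofPred_eq, not_exists, not_lt] at hcon
    have := opNorm_le_of_nets (matCLM (Matrix.of fun i j => y (i, j))) hN hN'
      (t := 4 * √(m : ℝ)) (by positivity) fun u hu v hv => by
        rw [inner_matCLM_of]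
        exact hcon (u, v) (Finset.mk_mem_product hu hv)
    have hy' : 16 * √(m : ℝ) < ‖matCLM (Matrix.of fun i j => y (i, j))‖ := hy
    linarith
  have hterm : ∀ q ∈ N' ×ˢ N, μ {y | 4 * √(m : ℝ) < ∑ p, y p * (q.1 p.1 * q.2 p.2)} ≤
      ENNReal.ofReal (Real.exp (-(8 * m))) := by
    intro q hq
    obtain ⟨hq1, hq2⟩ := Finset.mem_product.1 hq
    refine (pi_gaussian_linearForm_ge_le (fun p : Fin a × Fin b => q.1 p.1 * q.2 p.2) ?_
      (t := 4 * √(m : ℝ)) (by positivity)).trans (le_of_eq ?_)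
    · rw [Fintype.sum_prod_type]
      simp only [mul_pow, ← Finset.mul_sum, ← Finset.sum_mul]
      rw [← EuclideanSpace.real_norm_sq_eq, ← EuclideanSpace.real_norm_sq_eq, ← mul_pow]
      exact pow_le_one₀ (by positivity) (mul_le_one₀ (hN1' _ hq1) (norm_nonneg _) (hN1 _ hq2))
    · rw [mul_pow, Real.sq_sqrt (Nat.cast_nonneg m)]
      congr 2
      ring
  calc _ ≤ μ (⋃ q ∈ N' ×ˢ N, {y | 4 * √(m : ℝ) < ∑ p, y p * (q.1 p.1 * q.2 p.2)}) :=
        measure_mono hsub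
    _ ≤ ∑ q ∈ N' ×ˢ N, μ {y | 4 * √(m : ℝ) < ∑ p, y p * (q.1 p.1 * q.2 p.2)} :=
        measure_biUnion_finset_le _ _
    _ ≤ ∑ _q ∈ N' ×ˢ N, ENNReal.ofReal (Real.exp (-(8 * m))) := Finset.sum_le_sum hterm
    _ ≤ ENNReal.ofReal (Real.exp (4 * m)) * ENNReal.ofReal (Real.exp (-(8 * m))) := by
        rw [Finset.sum_const, nsmul_eq_mul]
        gcongr
        rw [← ENNReal.ofReal_natCast]
        refine ENNReal.ofReal_le_ofReal ?_
        have h1 : ((N' ×ˢ N).card : ℝ) ≤ 5 ^ m * 5 ^ m := by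
          rw [Finset.card_product]
          push_cast
          gcongr
          · calc ((N'.card : ℕ) : ℝ) ≤ ((5 ^ a : ℕ) : ℝ) := by exact_mod_cast hNcard'
              _ ≤ 5 ^ m := by push_cast; gcongr; norm_num
          · calc ((N.card : ℕ) : ℝ) ≤ ((5 ^ b : ℕ) : ℝ) := by exact_mod_cast hNcard
              _ ≤ 5 ^ m := by push_cast; gcongr; norm_num
        have h2 : (5 : ℝ) ≤ Real.exp 2 := by
          have h3 : Real.exp 2 = Real.exp 1 ^ 2 := by rw [← Real.exp_nat_mul]; norm_num
          rw [h3]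
          nlinarith [Real.exp_one_gt_d9]
        refine h1.trans ?_
        calc (5 : ℝ) ^ m * 5 ^ m ≤ Real.exp 2 ^ m * Real.exp 2 ^ m := by gcongr
          _ = Real.exp (4 * m) := by
            rw [← Real.exp_nat_mul, ← Real.exp_add]
            congr 1
            ring
    _ = _ := by
        rw [← ENNReal.ofReal_mul (Real.exp_pos _).le, ← Real.exp_add]
        congr 2
        ring

theorem norm_sq_matCLM_of {z : EuclideanSpace ℝ (Fin b)} (hz : z ≠ 0) (y : Fin a × Fin b → ℝ) :
    ‖matCLM (Matrix.of fun i j => y (i, j)) z‖ ^ 2 =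
      ‖z‖ ^ 2 * ∑ i, (∑ j, y (i, j) * (z j / ‖z‖)) ^ 2 := by
  have hz' : ‖z‖ ≠ 0 := norm_ne_zero_iff.2 hz
  rw [EuclideanSpace.real_norm_sq_eq, Finset.mul_sum]
  refine Finset.sum_congr rfl fun i _ => ?_
  rw [matCLM_apply_apply, ← mul_pow, Finset.mul_sum]
  congr 1
  refine Finset.sum_congr rfl fun j _ => ?_
  rw [Matrix.of_apply]
  field_simp

theorem sum_sq_normalize {z : EuclideanSpace ℝ (Fin b)} (hz : z ≠ 0) :
    ∑ j, (z j / ‖z‖) ^ 2 = 1 := by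
  have hz' : ‖z‖ ≠ 0 := norm_ne_zero_iff.2 hz
  simp only [div_pow]
  rw [← Finset.sum_div, ← EuclideanSpace.real_norm_sq_eq, div_self (pow_ne_zero 2 hz')]

/-- A Gaussian matrix does not shrink a given vector. -/
theorem pi_gaussian_norm_apply_lt_le {ε : ℝ} (hε0 : 0 < ε)
    (hε : ∫⁻ s, ENNReal.ofReal (Real.exp (-s ^ 2)) ∂(gaussianReal 0 1) ≤
      ENNReal.ofReal (Real.exp (-(2 * ε)))) (z : EuclideanSpace ℝ (Fin b)) :
    (Measure.pi fun _ : Fin a × Fin b => gaussianReal 0 1)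
      {y | ‖matCLM (Matrix.of fun i j => y (i, j)) z‖ < √ε * √(a : ℝ) * ‖z‖} ≤
      ENNReal.ofReal (Real.exp (-(ε * a))) := by
  rcases eq_or_ne z 0 with rfl | hz
  · simp
  have hmeas : MeasurableSet {s : Fin a → ℝ | ∑ i, s i ^ 2 < ε * a} :=
    measurableSet_lt (by fun_prop) measurable_const
  refine le_trans (le_of_eq ?_) (pi_gaussian_sum_sq_lt_le hε a)
  conv_rhs => rw [← map_mulVec_gaussian (a := a) _ (sum_sq_normalize hz),
    Measure.map_apply (by fun_prop) hmeas]
  congr 1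
  ext y
  change ‖matCLM (Matrix.of fun i j => y (i, j)) z‖ < √ε * √(a : ℝ) * ‖z‖ ↔
    ∑ i, (∑ j, y (i, j) * (z j / ‖z‖)) ^ 2 < ε * a
  have hz2 : 0 < ‖z‖ ^ 2 := pow_pos (norm_pos_iff.2 hz) 2
  rw [← sq_lt_sq₀ (norm_nonneg _) (by positivity), norm_sq_matCLM_of hz, mul_pow, mul_pow,
    Real.sq_sqrt hε0.le, Real.sq_sqrt (Nat.cast_nonneg a), mul_comm (ε * a),
    mul_lt_mul_iff_right₀ hz2]

theorem gaussianReal_abs_ge_le {t : ℝ} (ht : 0 ≤ t) :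
    gaussianReal 0 1 {s | t < |s|} ≤ ENNReal.ofReal (2 * Real.exp (-t ^ 2 / 2)) := by
  have hneg : gaussianReal 0 1 {s | t ≤ -s} = gaussianReal 0 1 {s | t ≤ s} := by
    have h := gaussianReal_map_neg (μ := 0) (v := 1)
    rw [neg_zero] at h
    conv_rhs => rw [← h]
    exact (Measure.map_apply measurable_neg measurableSet_Ici).symm
  calc _ ≤ gaussianReal 0 1 ({s | t ≤ s} ∪ {s | t ≤ -s}) := by
        refine measure_mono fun s hs => ?_
        rcases lt_abs.1 (show t < |s| from hs) with h | h
        · exact Or.inl h.le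
        · exact Or.inr h.le
    _ ≤ gaussianReal 0 1 {s | t ≤ s} + gaussianReal 0 1 {s | t ≤ -s} := measure_union_le _ _
    _ ≤ ENNReal.ofReal (Real.exp (-t ^ 2 / 2)) + ENNReal.ofReal (Real.exp (-t ^ 2 / 2)) := by
        rw [hneg]
        gcongr <;> exact gaussianReal_ge_le ht
    _ = _ := by
        rw [← ENNReal.ofReal_add (Real.exp_pos _).le (Real.exp_pos _).le, two_mul]

/-- A Gaussian matrix does not stretch a given vector by much. -/
theorem pi_gaussian_norm_apply_gt_le {t : ℝ} (ht : 0 ≤ t) (z : EuclideanSpace ℝ (Fin b)) :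
    (Measure.pi fun _ : Fin a × Fin b => gaussianReal 0 1)
      {y | a * t * ‖z‖ < ‖matCLM (Matrix.of fun i j => y (i, j)) z‖} ≤
      ENNReal.ofReal (a * (2 * Real.exp (-t ^ 2 / 2))) := by
  rcases eq_or_ne z 0 with rfl | hz
  · simp
  have hmeas : ∀ i : Fin a, MeasurableSet {s : Fin a → ℝ | t < |s i|} := fun i =>
    measurableSet_lt measurable_const (by fun_prop)
  have hz0 : 0 < ‖z‖ := norm_pos_iff.2 hz
  calc _ ≤ (Measure.pi fun _ : Fin a × Fin b => gaussianReal 0 1)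
        ((fun y i => ∑ j, y (i, j) * (z j / ‖z‖)) ⁻¹' ⋃ i : Fin a, {s | t < |s i|}) := by
        refine measure_mono fun y hy => ?_
        have hy' : a * t * ‖z‖ < ‖matCLM (Matrix.of fun i j => y (i, j)) z‖ := hy
        by_contra hcon
        simp only [Set.mem_preimage, Set.mem_iUnion, Set.mem_ofPred_eq, not_exists, not_lt] at hcon
        -- The estimate `a t² ≤ (a t)²` is crude but suffices: it will be used with `a` a fixed
        -- output dimension.
        have hsum : ∑ i, (∑ j, y (i, j) * (z j / ‖z‖)) ^ 2 ≤ (a * t) ^ 2 := by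
          calc _ ≤ ∑ _i : Fin a, t ^ 2 := by
                refine Finset.sum_le_sum fun i _ => ?_
                rw [← sq_abs]
                gcongr
                exact hcon i
            _ = a * t ^ 2 := by simp
            _ ≤ _ := by
                rw [mul_pow]
                gcongr
                exact_mod_cast Nat.le_self_pow two_ne_zero a
        have h2 := norm_sq_matCLM_of hz y
        have h3 : ‖matCLM (Matrix.of fun i j => y (i, j)) z‖ ^ 2 ≤ (a * t * ‖z‖) ^ 2 := by
          rw [h2, mul_pow (a * t : ℝ), mul_comm]
          gcongr
        exact absurd hy' (not_lt.2 ((sq_le_sq₀ (norm_nonneg _) (by positivity)).1 h3))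
    _ = (Measure.pi fun _ : Fin a => gaussianReal 0 1) (⋃ i : Fin a, {s | t < |s i|}) := by
        conv_rhs => rw [← map_mulVec_gaussian (a := a) _ (sum_sq_normalize hz)]
        exact (Measure.map_apply (by fun_prop) (MeasurableSet.iUnion hmeas)).symm
    _ ≤ ∑ i : Fin a, (Measure.pi fun _ : Fin a => gaussianReal 0 1) {s | t < |s i|} :=
        measure_iUnion_fintype_le _ _
    _ ≤ ∑ _i : Fin a, ENNReal.ofReal (2 * Real.exp (-t ^ 2 / 2)) := by
        refine Finset.sum_le_sum fun i _ => le_trans (le_of_eq ?_) (gaussianReal_abs_ge_le ht)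
        exact (measurePreserving_eval (fun _ : Fin a => gaussianReal 0 1) i).measure_preimage
          (s := {s | t < |s|})
          (measurableSet_lt measurable_const (by fun_prop)).nullMeasurableSet
    _ = _ := by
        rw [Finset.sum_const, Finset.card_univ, Fintype.card_fin, nsmul_eq_mul,
          ENNReal.ofReal_mul (Nat.cast_nonneg a), ENNReal.ofReal_natCast]

end GaussianMatrix

/-! ### Events of the random initialization -/

section Initialization

variable {B : ℕ} {d : Fin (B + 1) → ℕ} {k : Fin B → ℕ} {m : ℕ}

theorem initLaw_apply (S : Set (Params d k m)) :
    initLaw d k m S =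
      (Measure.pi fun _ : WeightIdx d k m => gaussianReal 0 1) (WithLp.toLp 2 ⁻¹' S) :=
  (MeasurableEquiv.toLp 2 (WeightIdx d k m → ℝ)).map_apply S

/-- The law of a single weight matrix. -/
theorem initLaw_layer_le (p : LayerIdx k)
    (S : Set (Fin (layerWidth m (k p.1) (d p.1.castSucc) (d p.1.succ) p.2.succ) ×
      Fin (layerWidth m (k p.1) (d p.1.castSucc) (d p.1.succ) p.2.castSucc) → ℝ)) :
    initLaw d k m {W | (fun y => W ⟨p, y⟩) ∈ S} ≤ (Measure.pi fun _ => gaussianReal 0 1) S := by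
  have hp := measurePreserving_comp_injective (ι := WeightIdx d k m) (gaussianReal 0 1)
    (sigma_mk_injective (i := p))
  rw [initLaw_apply]
  conv_rhs => rw [← hp.map_eq]
  exact Measure.le_map_apply hp.measurable.aemeasurable S

/-- Conditioning on the other layers: an event for a weight matrix and a function of the other
weight matrices. -/
theorem initLaw_layer_cond_le (p : LayerIdx k) {E : Type*} [MeasurableSpace E]
    (h : Params d k m → E) (hmeas : Measurable h)
    (hdep : ∀ U V : Params d k m, (∀ i, i.1 ≠ p → U i = V i) → h U = h V)
    (Q : Set ((Fin (layerWidth m (k p.1) (d p.1.castSucc) (d p.1.succ) p.2.succ) ×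
      Fin (layerWidth m (k p.1) (d p.1.castSucc) (d p.1.succ) p.2.castSucc) → ℝ) × E))
    (hQ : MeasurableSet Q) (ε : ENNReal)
    (hε : ∀ z, (Measure.pi fun _ => gaussianReal 0 1) {y | (y, z) ∈ Q} ≤ ε) :
    initLaw d k m {W | ((fun y => W ⟨p, y⟩), h W) ∈ Q} ≤ ε := by
  classical
  rw [initLaw_apply]
  have hE : MeasurableSet (WithLp.toLp 2 ⁻¹'
      {W : Params d k m | ((fun y => W ⟨p, y⟩), h W) ∈ Q}) := by
    have h1 : Measurable fun w : WeightIdx d k m → ℝ =>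
        ((fun y => w ⟨p, y⟩), h (WithLp.toLp 2 w)) :=
      (measurable_pi_lambda _ fun y => measurable_pi_apply _).prodMk
        (hmeas.comp (WithLp.measurable_toLp 2 _))
    exact h1 hQ
  -- Only layer `p` is resampled. As `h` ignores it, `h` keeps its value at the frozen `w` and the
  -- bound for a fixed vector applies.
  refine pi_le_of_forall_piecewise _ {i : WeightIdx d k m | i.1 = p} hE ε fun w => ?_
  have hpr := measurePreserving_comp_injective (ι := WeightIdx d k m) (gaussianReal 0 1)
    (sigma_mk_injective (i := p))
  refine le_trans ?_ (hε (h (WithLp.toLp 2 w)))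
  conv_rhs => rw [← hpr.map_eq]
  refine le_trans (measure_mono fun w' hw' => ?_)
    (Measure.le_map_apply hpr.measurable.aemeasurable _)
  have hw2 : ((fun y => ({i : WeightIdx d k m | i.1 = p}.piecewise w' w) ⟨p, y⟩),
      h (WithLp.toLp 2 ({i : WeightIdx d k m | i.1 = p}.piecewise w' w))) ∈ Q := hw'
  rw [hdep _ (WithLp.toLp 2 w) fun i hi => by
    exact Set.piecewise_eq_of_notMem {i : WeightIdx d k m | i.1 = p} w' w hi] at hw2
  have hw3 : (fun y => ({i : WeightIdx d k m | i.1 = p}.piecewise w' w) ⟨p, y⟩) =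
      w' ∘ Sigma.mk p := by
    ext y
    exact Set.piecewise_eq_of_mem _ _ _ rfl
  rw [hw3] at hw2
  exact hw2

theorem layerWidth_le {m k din dout : ℕ} (hdin : din ≤ m) (hdout : dout ≤ m) (ℓ : Fin (k + 3)) :
    layerWidth m k din dout ℓ ≤ m := by
  unfold layerWidth
  split_ifs <;> omega

theorem layerWidth_hidden {m k din dout : ℕ} (ℓ : Fin (k + 1)) :
    layerWidth m k din dout ℓ.castSucc.succ = m := by
  rw [layerWidth, if_neg (Fin.succ_ne_zero _), if_neg]
  rw [Fin.succ_castSucc]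
  exact (Fin.castSucc_lt_last _).ne

theorem initLaw_norm_layersCLM_le (hdm : ∀ b, d b ≤ m) :
    initLaw d k m {W | 16 * √(m : ℝ) < ‖layersCLM d k m W‖} ≤
      ENNReal.ofReal (Fintype.card (LayerIdx k) * Real.exp (-(4 * m))) := by
  calc _ ≤ initLaw d k m (⋃ p : LayerIdx k,
        {W | 16 * √(m : ℝ) < ‖matCLM (weightMatrix W p.1 p.2)‖}) := by
        refine measure_mono fun W hW => ?_
        by_contra hcon
        simp only [Set.mem_iUnion, Set.mem_ofPred_eq, not_exists, not_lt] at hcon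
        have : ‖layersCLM d k m W‖ ≤ 16 * √(m : ℝ) := by
          rw [pi_norm_le_iff_of_nonneg (by positivity)]
          exact hcon
        exact absurd (show 16 * √(m : ℝ) < ‖layersCLM d k m W‖ from hW) (not_lt.2 this)
    _ ≤ ∑ p : LayerIdx k, initLaw d k m
          {W | 16 * √(m : ℝ) < ‖matCLM (weightMatrix W p.1 p.2)‖} :=
        measure_iUnion_fintype_le _ _
    _ ≤ ∑ _p : LayerIdx k, ENNReal.ofReal (Real.exp (-(4 * m))) :=
        Finset.sum_le_sum fun p _ =>
          (initLaw_layer_le p {y | 16 * √(m : ℝ) < ‖matCLM (Matrix.of fun i j => y (i, j))‖}).trans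
            (pi_gaussian_opNorm_gt_le (layerWidth_le (hdm _) (hdm _) _)
              (layerWidth_le (hdm _) (hdm _) _))
    _ = _ := by
        rw [Finset.sum_const, Finset.card_univ, nsmul_eq_mul,
          ENNReal.ofReal_mul (Nat.cast_nonneg _), ENNReal.ofReal_natCast]

theorem continuous_blockNode (b : Fin B) (z : EuclideanSpace ℝ (Fin (d b.castSucc)))
    (i : Fin (k b + 3)) : Continuous fun W : Params d k m => blockNode W b z i := by
  induction i using Fin.induction with
  | zero => exact continuous_const
  | succ i ih =>
    simp only [blockNode_succ]
    exact (layerCLM d k m ⟨b, i⟩).continuous.clm_apply ih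

/-- The input of layer `ℓ` involves only earlier layers of the block. This is the independence
needed for `initLaw_layer_cond_le`. -/
theorem blockNode_congr (b : Fin B) (z : EuclideanSpace ℝ (Fin (d b.castSucc)))
    (ℓ : Fin (k b + 2)) {U V : Params d k m} (h : ∀ i : WeightIdx d k m, i.1 ≠ ⟨b, ℓ⟩ → U i = V i) :
    blockNode U b z ℓ.castSucc = blockNode V b z ℓ.castSucc := by
  unfold blockNode
  rw [chain_congr]
  intro j hj
  rw [blockLayersCLM_apply, blockLayersCLM_apply, weightMatrix_congr]
  rintro i hi
  refine h i fun hi' => ?_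
  have hjl : j = ℓ := by simpa using hi.symm.trans hi'
  rw [hjl] at hj
  exact lt_irrefl _ hj

theorem continuous_matCLM_apply {a b : ℕ} :
    Continuous fun q : (Fin a × Fin b → ℝ) × EuclideanSpace ℝ (Fin b) =>
      matCLM (Matrix.of fun i j => q.1 (i, j)) q.2 := by
  have h : Continuous fun q : (Fin a × Fin b → ℝ) × EuclideanSpace ℝ (Fin b) =>
      (matCLM (Matrix.of fun i j => q.1 (i, j)) :
        EuclideanSpace ℝ (Fin b) →L[ℝ] EuclideanSpace ℝ (Fin a)) :=
    (LinearMap.continuous_of_finiteDimensional matCLM).comp (by fun_prop)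
  exact h.clm_apply continuous_snd

theorem initLaw_not_nodesGrow_le (hd : ∀ b, 1 ≤ d b) (x : EuclideanSpace ℝ (Fin (d 0)))
    {ε : ℝ} (hε0 : 0 < ε)
    (hε : ∫⁻ s, ENNReal.ofReal (Real.exp (-s ^ 2)) ∂(gaussianReal 0 1) ≤
      ENNReal.ofReal (Real.exp (-(2 * ε)))) :
    initLaw d k m {W | ¬ NodesGrow hd x √ε W} ≤
      ENNReal.ofReal (Fintype.card (Σ b : Fin B, Fin (k b + 1)) * Real.exp (-(ε * m))) := by
  calc _ ≤ initLaw d k m (⋃ p : Σ b : Fin B, Fin (k b + 1),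
        {W | ‖matCLM (weightMatrix W p.1 p.2.castSucc)
            (blockNode W p.1 (startVec hd x p.1.castSucc) p.2.castSucc.castSucc)‖ <
          √ε * √(m : ℝ) *
            ‖blockNode W p.1 (startVec hd x p.1.castSucc) p.2.castSucc.castSucc‖}) := by
        refine measure_mono fun W hW => ?_
        have hW' : ¬ NodesGrow hd x √ε W := hW
        simp only [NodesGrow, not_forall, not_le] at hW'
        obtain ⟨b, ℓ, h⟩ := hW'
        exact Set.mem_iUnion.2 ⟨⟨b, ℓ⟩, h⟩
    _ ≤ ∑ p : Σ b : Fin B, Fin (k b + 1), initLaw d k m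
        {W | ‖matCLM (weightMatrix W p.1 p.2.castSucc)
            (blockNode W p.1 (startVec hd x p.1.castSucc) p.2.castSucc.castSucc)‖ <
          √ε * √(m : ℝ) *
            ‖blockNode W p.1 (startVec hd x p.1.castSucc) p.2.castSucc.castSucc‖} :=
        measure_iUnion_fintype_le _ _
    _ ≤ ∑ _p : Σ b : Fin B, Fin (k b + 1), ENNReal.ofReal (Real.exp (-(ε * m))) := by
        refine Finset.sum_le_sum fun p _ => ?_
        -- Given the other layers, the node is a fixed vector and this layer is a fresh Gaussian
        -- matrix with `m` rows.
        refine initLaw_layer_cond_le ⟨p.1, p.2.castSucc⟩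
          (fun W => blockNode W p.1 (startVec hd x p.1.castSucc) p.2.castSucc.castSucc)
          (continuous_blockNode _ _ _).measurable (fun U V h => blockNode_congr _ _ _ h)
          {q | ‖matCLM (Matrix.of fun i j => q.1 (i, j)) q.2‖ < √ε * √(m : ℝ) * ‖q.2‖}
          (measurableSet_lt continuous_matCLM_apply.norm.measurable (by fun_prop)) _ fun z => ?_
        have h := pi_gaussian_norm_apply_lt_le (a := layerWidth m (k p.1) (d p.1.castSucc)
          (d p.1.succ) p.2.castSucc.succ) hε0 hε z
        have hw : ((layerWidth m (k p.1) (d p.1.castSucc) (d p.1.succ)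
            p.2.castSucc.succ : ℕ) : ℝ) = m := by rw [layerWidth_hidden]
        rw [hw] at h
        exact h
    _ = _ := by
        rw [Finset.sum_const, Finset.card_univ, nsmul_eq_mul,
          ENNReal.ofReal_mul (Nat.cast_nonneg _), ENNReal.ofReal_natCast]

/-- The last layer of each block does not stretch the last hidden layer by much, on basis
vectors. -/
def OutputsBounded (t : ℝ) (W : Params d k m) : Prop :=
  ∀ (b : Fin B) (j : Fin (d b.castSucc)),
    ‖matCLM (weightMatrix W b (Fin.last (k b + 1)))
      (blockNode W b (EuclideanSpace.single j 1) (Fin.last (k b + 1)).castSucc)‖ ≤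
    d b.succ * t * ‖blockNode W b (EuclideanSpace.single j 1) (Fin.last (k b + 1)).castSucc‖

/-- The last layer of a block has a fixed number of rows, so its action on a given vector
concentrates only through `t`: the bound does not improve with `m`. -/
theorem initLaw_not_outputsBounded_le {t : ℝ} (ht : 0 ≤ t) :
    initLaw d k m {W | ¬ OutputsBounded t W} ≤ ENNReal.ofReal
      ((∑ p : Σ b : Fin B, Fin (d b.castSucc), (d p.1.succ : ℝ) * 2) * Real.exp (-t ^ 2 / 2)) := by
  calc _ ≤ initLaw d k m (⋃ p : Σ b : Fin B, Fin (d b.castSucc),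
        {W | d p.1.succ * t * ‖blockNode W p.1 (EuclideanSpace.single p.2 1)
            (Fin.last (k p.1 + 1)).castSucc‖ <
          ‖matCLM (weightMatrix W p.1 (Fin.last (k p.1 + 1)))
            (blockNode W p.1 (EuclideanSpace.single p.2 1)
              (Fin.last (k p.1 + 1)).castSucc)‖}) := by
        refine measure_mono fun W hW => ?_
        have hW' : ¬ OutputsBounded t W := hW
        simp only [OutputsBounded, not_forall, not_le] at hW'
        obtain ⟨b, ℓ, h⟩ := hW'
        exact Set.mem_iUnion.2 ⟨⟨b, ℓ⟩, h⟩
    _ ≤ ∑ p : Σ b : Fin B, Fin (d b.castSucc), initLaw d k m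
        {W | d p.1.succ * t * ‖blockNode W p.1 (EuclideanSpace.single p.2 1)
            (Fin.last (k p.1 + 1)).castSucc‖ <
          ‖matCLM (weightMatrix W p.1 (Fin.last (k p.1 + 1)))
            (blockNode W p.1 (EuclideanSpace.single p.2 1)
              (Fin.last (k p.1 + 1)).castSucc)‖} :=
        measure_iUnion_fintype_le _ _
    _ ≤ ∑ p : Σ b : Fin B, Fin (d b.castSucc),
        ENNReal.ofReal (d p.1.succ * (2 * Real.exp (-t ^ 2 / 2))) := by
        refine Finset.sum_le_sum fun p _ => ?_
        refine initLaw_layer_cond_le ⟨p.1, Fin.last (k p.1 + 1)⟩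
          (fun W => blockNode W p.1 (EuclideanSpace.single p.2 1)
            (Fin.last (k p.1 + 1)).castSucc)
          (continuous_blockNode _ _ _).measurable (fun U V h => blockNode_congr _ _ _ h)
          {q | d p.1.succ * t * ‖q.2‖ < ‖matCLM (Matrix.of fun i j => q.1 (i, j)) q.2‖}
          (measurableSet_lt (by fun_prop) continuous_matCLM_apply.norm.measurable) _ fun z => ?_
        have h := pi_gaussian_norm_apply_gt_le (a := layerWidth m (k p.1) (d p.1.castSucc)
          (d p.1.succ) (Fin.last (k p.1 + 1)).succ) ht z
        have hw : ((layerWidth m (k p.1) (d p.1.castSucc) (d p.1.succ)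
            (Fin.last (k p.1 + 1)).succ : ℕ) : ℝ) = d p.1.succ := by
          rw [Fin.succ_last, layerWidth_last]
        rw [hw] at h
        exact h
    _ = _ := by
        rw [← ENNReal.ofReal_sum_of_nonneg fun _ _ => by positivity, Finset.sum_mul]
        congr 1
        exact Finset.sum_congr rfl fun _ _ => by ring

theorem norm_blockNode_le {K : ℝ} (hK : 0 ≤ K) {W : Params d k m}
    (hW : ‖layersCLM d k m W‖ ≤ K * √(m : ℝ)) (b : Fin B)
    (z : EuclideanSpace ℝ (Fin (d b.castSucc))) (i : Fin (k b + 3)) :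
    ‖blockNode W b z i‖ ≤ (K * √(m : ℝ)) ^ (i : ℕ) * ‖z‖ := by
  induction i using Fin.induction with
  | zero => rw [norm_blockNode_zero, Fin.val_zero, pow_zero, one_mul]
  | succ i ih =>
    rw [blockNode_succ, Fin.val_succ, pow_succ', mul_assoc]
    refine (ContinuousLinearMap.le_opNorm _ _).trans ?_
    refine mul_le_mul ?_ ih (norm_nonneg _) (by positivity)
    exact (norm_le_pi_norm (layersCLM d k m W) ⟨b, i⟩).trans hW

theorem opNorm_le_sum_single {a : ℕ} {F : Type*} [NormedAddCommGroup F] [NormedSpace ℝ F]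
    (T : EuclideanSpace ℝ (Fin a) →L[ℝ] F) : ‖T‖ ≤ ∑ j, ‖T (EuclideanSpace.single j 1)‖ := by
  refine T.opNorm_le_bound (Finset.sum_nonneg fun _ _ => norm_nonneg _) fun z => ?_
  have hz : z = ∑ j, z j • EuclideanSpace.single j (1 : ℝ) := by
    ext i
    simp [Pi.single_apply]
  conv_lhs => rw [hz, map_sum]
  refine (norm_sum_le _ _).trans ?_
  rw [Finset.sum_mul]
  refine Finset.sum_le_sum fun j _ => ?_
  rw [map_smul, norm_smul, mul_comm]
  gcongr
  exact PiLp.norm_apply_le z j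

/-- Using the norm `K √m` for the last layer too would lose a factor `√m`. Testing that layer only
on the images of the basis vectors avoids this, and the hidden layers cancel against the
normalization. -/
theorem OutputsBounded.norm_blockOps_le (hd : ∀ b, 1 ≤ d b) (hm : 1 ≤ m) {t : ℝ} (ht : 0 ≤ t)
    {K : ℝ} (hK : 0 ≤ K)
    {W : Params d k m} (h : OutputsBounded t W) (hW : ‖layersCLM d k m W‖ ≤ K * √(m : ℝ))
    (b : Fin B) :
    ‖blockOps d k m W b‖ ≤ d b.castSucc * (d b.succ * t * K ^ (k b + 1)) := by
  have hs : 0 < √(m : ℝ) := Real.sqrt_pos.2 (by exact_mod_cast hm)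
  refine (opNorm_le_sum_single _).trans ?_
  calc _ ≤ ∑ _j : Fin (d b.castSucc), (d b.succ * t * K ^ (k b + 1)) := by
        refine Finset.sum_le_sum fun j _ => ?_
        rw [norm_blockOps_apply]
        have h1 : ‖blockNode W b (EuclideanSpace.single j 1) (Fin.last (k b + 2))‖ ≤
            d b.succ * t * (K * √(m : ℝ)) ^ (k b + 1) := by
          rw [← Fin.succ_last, blockNode_succ]
          refine (h b j).trans ?_
          refine mul_le_mul_of_nonneg_left ?_ (by positivity)
          refine (norm_blockNode_le hK hW b _ _).trans (le_of_eq ?_)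
          simp
        calc _ ≤ (1 / √(m : ℝ)) ^ (k b + 1) * (d b.succ * t * (K * √(m : ℝ)) ^ (k b + 1)) :=
              mul_le_mul (blockScale_le (hd _)) h1 (norm_nonneg _) (by positivity)
          _ = _ := by
              rw [one_div, inv_pow, mul_pow]
              field_simp
    _ = _ := by simp

end Initialization

/-! ### The transition to polynomials of degree `B` -/

section Transition

theorem exists_forall_mul_exp_neg_le (N : ℝ) {c δ : ℝ} (hc : 0 < c) (hδ : 0 < δ) :
    ∃ m₀ : ℕ, ∀ m : ℕ, m₀ ≤ m → N * Real.exp (-(c * m)) ≤ δ := by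
  have h : Filter.Tendsto (fun m : ℕ => N * Real.exp (-(c * m))) Filter.atTop (nhds (N * 0)) := by
    refine (Real.tendsto_exp_neg_atTop_nhds_zero.comp ?_).const_mul N
    exact tendsto_natCast_atTop_atTop.const_mul_atTop hc
  rw [mul_zero] at h
  exact Filter.eventually_atTop.1 (h.eventually_le_const hδ)

variable {B : ℕ} {d : Fin (B + 1) → ℕ} (k : Fin B → ℕ)

/-- With probability exponentially close to one, all weight matrices have norm at most `16 √m` and
the hidden nodes of all blocks grow. -/
theorem exists_initLaw_regular (hd : ∀ b, 1 ≤ d b) : ∃ ε : ℝ, 0 < ε ∧ ∃ c : ℝ, 0 < c ∧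
    ∃ m₀ : ℕ, 1 ≤ m₀ ∧ ∀ m : ℕ, m₀ ≤ m → ∀ x : EuclideanSpace ℝ (Fin (d 0)),
      initLaw d k m ({W | 16 * √(m : ℝ) < ‖layersCLM d k m W‖} ∪ {W | ¬ NodesGrow hd x ε W}) ≤
        ENNReal.ofReal (Real.exp (-(c * m))) := by
  obtain ⟨ε, hε0, hε⟩ := exists_lintegral_exp_neg_sq_gaussian_le
  obtain ⟨N₁, hN₁⟩ : ∃ N : ℝ, N = ((Fintype.card (LayerIdx k) : ℕ) : ℝ) := ⟨_, rfl⟩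
  obtain ⟨N₂, hN₂⟩ : ∃ N : ℝ, N = ((Fintype.card (Σ b : Fin B, Fin (k b + 1)) : ℕ) : ℝ) := ⟨_, rfl⟩
  -- Both exponents are at least `2c`; half of the decay absorbs the prefactor `N₁ + N₂` for large
  -- `m`.
  set c : ℝ := min ε 4 / 2 with hc
  have hN₁0 : 0 ≤ N₁ := hN₁ ▸ Nat.cast_nonneg _
  have hN₂0 : 0 ≤ N₂ := hN₂ ▸ Nat.cast_nonneg _
  have hc0 : 0 < c := by positivity
  obtain ⟨m₁, hm₁⟩ := exists_forall_mul_exp_neg_le (N₁ + N₂) hc0 one_pos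
  -- The term `∑ b, d b` makes `m` exceed all bottleneck dimensions, as the operator norm bound
  -- requires.
  refine ⟨√ε, Real.sqrt_pos.2 hε0, c, hc0, max (max m₁ 1) (∑ b, d b),
    (le_max_right m₁ 1).trans (le_max_left _ _), fun m hm x => ?_⟩
  have hmm₁ : m₁ ≤ m := (le_max_left _ _).trans ((le_max_left _ _).trans hm)
  have hdm : ∀ b, d b ≤ m := fun b =>
    (Finset.single_le_sum (f := d) (fun _ _ => Nat.zero_le _) (Finset.mem_univ b)).trans
      ((le_max_right _ _).trans hm)
  have hm0 : (0 : ℝ) ≤ m := Nat.cast_nonneg m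
  have h4 : Real.exp (-(4 * m)) ≤ Real.exp (-(2 * c * m)) := by
    refine Real.exp_le_exp.2 (neg_le_neg (mul_le_mul_of_nonneg_right ?_ hm0))
    linarith [min_le_right ε 4]
  have hε' : Real.exp (-(ε * m)) ≤ Real.exp (-(2 * c * m)) := by
    refine Real.exp_le_exp.2 (neg_le_neg (mul_le_mul_of_nonneg_right ?_ hm0))
    linarith [min_le_left ε 4]
  calc _ ≤ ENNReal.ofReal (N₁ * Real.exp (-(4 * m))) +
        ENNReal.ofReal (N₂ * Real.exp (-(ε * m))) :=
        (measure_union_le _ _).trans (add_le_add (hN₁ ▸ initLaw_norm_layersCLM_le hdm)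
          (hN₂ ▸ initLaw_not_nodesGrow_le hd x hε0 hε))
    _ = ENNReal.ofReal (N₁ * Real.exp (-(4 * m)) + N₂ * Real.exp (-(ε * m))) :=
        (ENNReal.ofReal_add (by positivity) (by positivity)).symm
    _ ≤ _ := by
        refine ENNReal.ofReal_le_ofReal ?_
        calc _ ≤ N₁ * Real.exp (-(2 * c * m)) + N₂ * Real.exp (-(2 * c * m)) := by gcongr
          _ = ((N₁ + N₂) * Real.exp (-(c * m))) * Real.exp (-(c * m)) := by
              rw [← add_mul, mul_assoc (N₁ + N₂), ← Real.exp_add]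
              congr 2
              ring
          _ ≤ 1 * Real.exp (-(c * m)) := by
              gcongr
              exact hm₁ m hmm₁
          _ = _ := one_mul _

theorem exists_initLaw_outputsBounded {δ : ℝ} (hδ : 0 < δ) : ∃ t : ℝ, 0 ≤ t ∧ ∀ m : ℕ,
    initLaw d k m {W | ¬ OutputsBounded t W} ≤ ENNReal.ofReal δ := by
  obtain ⟨n, hn⟩ := exists_forall_mul_exp_neg_le
    (∑ p : Σ b : Fin B, Fin (d b.castSucc), (d p.1.succ : ℝ) * 2) (half_pos one_pos) hδ
  -- With `t = √n` the tail `exp (-t ^ 2 / 2)` is the exponential of `-(1 / 2) n`, the rate used to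
  -- choose `n`.
  refine ⟨√n, Real.sqrt_nonneg _, fun m => ?_⟩
  refine (initLaw_not_outputsBounded_le (Real.sqrt_nonneg _)).trans
    (ENNReal.ofReal_le_ofReal (le_trans (le_of_eq ?_) (hn n le_rfl)))
  rw [Real.sq_sqrt (Nat.cast_nonneg n)]
  congr 2
  ring

end Transition

theorem theorem2 (B : ℕ) (hB : 1 ≤ B) (d : Fin (B + 1) → ℕ) (hd : ∀ b, 1 ≤ d b)
    (k : Fin B → ℕ) :
    -- with probability `1 - exp (-Ω(m))`: approximation by the `B`-jet, and its degree
    (∃ c : ℝ, 0 < c ∧ ∃ κ : ℝ, 0 < κ ∧ ∃ m₀ : ℕ, 1 ≤ m₀ ∧ ∀ R : ℝ, 0 < R → ∃ C : ℝ, 0 < C ∧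
      ∀ m : ℕ, m₀ ≤ m → ∀ x : EuclideanSpace ℝ (Fin (d 0)),
        initLaw d k m {W₀ : Params d k m | ¬ (
          (∀ W ∈ weightBall W₀ R, ‖bnn x W - jet B (bnn x) W₀ (W - W₀)‖ ≤ C * ‖x‖ / √(m : ℝ)) ∧
          (∀ W ∈ weightBall W₀ R,
            ‖iteratedFDeriv ℝ (B + 1) (bnn (d := d) (k := k) (m := m) x) W‖
              ≤ C * ‖x‖ / √(m : ℝ)) ∧
          κ * ‖x‖ ≤ ‖iteratedFDeriv ℝ B (bnn (d := d) (k := k) (m := m) x) W₀‖ ∧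
          (x ≠ 0 → IsPolynomialOfDegree B
            (fun W : Params d k m => jet B (bnn x) W₀ (W - W₀))))}
        ≤ ENNReal.ofReal (Real.exp (-(c * (m : ℝ))))) ∧
    -- the `B`-jet is affine in each weight matrix
    (∀ (m : ℕ) (x : EuclideanSpace ℝ (Fin (d 0))) (W₀ : Params d k m) (p : LayerIdx k),
      IsAffineInCoords {i : WeightIdx d k m | i.1 = p}
        (fun W : Params d k m => jet B (bnn x) W₀ (W - W₀))) ∧
    -- as `m → ∞`, the network is approximated, at rate `1 / √m` in probability, by a polynomial
    -- of degree `B` that is affine in each of the `B` blocks of weights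
    (∀ R : ℝ, 0 < R → ∀ δ : ℝ, 0 < δ → ∃ C : ℝ, 0 < C ∧ ∃ m₀ : ℕ, 1 ≤ m₀ ∧
      ∀ m : ℕ, m₀ ≤ m → ∀ x : EuclideanSpace ℝ (Fin (d 0)),
        initLaw d k m {W₀ : Params d k m | ¬ (
          ∃ q : Params d k m → EuclideanSpace ℝ (Fin (d (Fin.last B))),
            (x ≠ 0 → IsPolynomialOfDegree B q) ∧
            (∀ b : Fin B, IsAffineInCoords {i : WeightIdx d k m | i.1.1 = b} q) ∧
            ∀ W ∈ weightBall W₀ R, ‖bnn x W - q W‖ ≤ C * ‖x‖ / √(m : ℝ))}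
        ≤ ENNReal.ofReal δ) := by
  obtain ⟨ε, hε, c, hc, m₀, hm₀, hreg⟩ := exists_initLaw_regular k hd
  refine ⟨⟨c, hc, ∏ b : Fin B, (1 / √(d b.castSucc : ℝ) * ε ^ (k b + 1)), ?_, m₀, hm₀, ?_⟩,
    fun m x W₀ p => isAffineInCoords_jet_bnn B x W₀ p, ?_⟩
  · refine Finset.prod_pos fun b _ => mul_pos ?_ (pow_pos hε _)
    exact one_div_pos.2 (Real.sqrt_pos.2 (by exact_mod_cast hd _))
  · intro R hR
    set C₁ : ℝ := ((Fintype.card (LayerIdx k)).descFactorial (B + 1) : ℝ) *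
      (16 + R) ^ (Fintype.card (LayerIdx k) - (B + 1))
    have hC₁ : 0 ≤ C₁ := by positivity
    -- Covers the Taylor error and the bound of the derivative of order `B + 1`; the last summand
    -- ensures positivity. Only this constant depends on `R`.
    refine ⟨C₁ * R ^ (B + 1) + C₁ + 1, by positivity, fun m hm x => ?_⟩
    -- Off the exceptional set all four claims hold deterministically.
    refine (measure_mono fun W₀ hW₀ => ?_).trans (hreg m hm x)
    by_contra hgood
    rw [Set.mem_union, not_or] at hgood
    have hop : ‖layersCLM d k m W₀‖ ≤ 16 * √(m : ℝ) := not_lt.1 hgood.1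
    have hgrow : NodesGrow hd x ε W₀ := not_not.1 hgood.2
    have hm1 : 1 ≤ m := hm₀.trans hm
    have hmono : ∀ {a : ℝ}, a ≤ C₁ * R ^ (B + 1) + C₁ + 1 →
        a * ‖x‖ / √(m : ℝ) ≤ (C₁ * R ^ (B + 1) + C₁ + 1) * ‖x‖ / √(m : ℝ) := by
      intro a ha
      gcongr
    have hR1 : 0 ≤ C₁ * R ^ (B + 1) := by positivity
    have hlow := hgrow.le_norm_iteratedFDeriv hB hm1 hε.le (contDiff_bnn x)
      (bnn_add_sum_testDir hd x W₀)
    refine hW₀ ⟨fun W hW => ?_, fun W hW => ?_, hlow, fun hx => ?_⟩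
    · exact (norm_bnn_sub_jet_le hB hd x hm1 (by norm_num) hR.le hop hW).trans
        (hmono (by linarith))
    · exact (norm_iteratedFDeriv_bnn_le hB hd x hm1 (by positivity) W
        (norm_layersCLM_le_of_mem hm1 hR.le hop hW)).trans (hmono (by linarith))
    · refine isPolynomialOfDegree_jet_sub B (contDiff_bnn x) W₀ (lt_of_lt_of_le ?_ hlow)
      refine mul_pos (Finset.prod_pos fun b _ => mul_pos ?_ (pow_pos hε _)) (norm_pos_iff.2 hx)
      exact one_div_pos.2 (Real.sqrt_pos.2 (by exact_mod_cast hd _))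
  · intro R hR δ hδ
    obtain ⟨t, ht, hout⟩ := exists_initLaw_outputsBounded (d := d) k (half_pos hδ)
    obtain ⟨m₁, hm₁⟩ := exists_forall_mul_exp_neg_le 1 hc (half_pos hδ)
    -- Sums over the blocks serve as common bounds for the constants of the single blocks, with `K =
    -- 16` from the operator norm event.
    set T : ℝ := ∑ b : Fin B, d b.castSucc * (d b.succ * t * 16 ^ (k b + 1))
    set E₁ : ℝ := ∑ b : Fin B, ((k b + 2).descFactorial 1 : ℝ) * (16 + R) ^ (k b + 1) * R
    set E₂ : ℝ := ∑ b : Fin B, ((k b + 2).descFactorial 2 : ℝ) * (16 + R) ^ (k b) * R ^ 2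
    have hT : 0 ≤ T := Finset.sum_nonneg fun _ _ => by positivity
    have hE₁ : 0 ≤ E₁ := Finset.sum_nonneg fun _ _ => by positivity
    have hE₂ : 0 ≤ E₂ := Finset.sum_nonneg fun _ _ => by positivity
    have hC : 0 ≤ B * (T + E₁ + E₂) ^ (B - 1) * E₂ := by positivity
    refine ⟨B * (T + E₁ + E₂) ^ (B - 1) * E₂ + 1, by positivity, max m₀ m₁,
      hm₀.trans (le_max_left _ _), fun m hm x => ?_⟩
    have hmm₀ : m₀ ≤ m := (le_max_left _ _).trans hm
    have hm1 : 1 ≤ m := hm₀.trans hmm₀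
    calc _ ≤ initLaw d k m (({W | 16 * √(m : ℝ) < ‖layersCLM d k m W‖} ∪
          {W | ¬ NodesGrow hd x ε W}) ∪ {W | ¬ OutputsBounded t W}) := by
          refine measure_mono fun W₀ hW₀ => ?_
          by_contra hgood
          rw [Set.mem_union, Set.mem_union, not_or, not_or] at hgood
          have hop : ‖layersCLM d k m W₀‖ ≤ 16 * √(m : ℝ) := not_lt.1 hgood.1.1
          have hgrow : NodesGrow hd x ε W₀ := not_not.1 hgood.1.2
          have hbdd : OutputsBounded t W₀ := not_not.1 hgood.2
          refine hW₀ ⟨fun W => outerMap d x (linBlock W₀ W),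
            hgrow.isPolynomialOfDegree_outerMap_linBlock hB hm1 hε,
            fun b => isAffineInCoords_outerMap_linBlock x W₀ b, fun W hW => ?_⟩
          refine (norm_bnn_sub_outerMap_linBlock_le (E₁ := E₁) (E₂ := E₂) (T := T) hd x hm1
            (by norm_num) hR.le (fun b => ?_) (fun b => ?_) hT hE₁ hE₂ hop (fun b => ?_) hW).trans
            ?_
          · exact Finset.single_le_sum
              (f := fun b : Fin B => ((k b + 2).descFactorial 1 : ℝ) * (16 + R) ^ (k b + 1) * R)
              (fun _ _ => by positivity) (Finset.mem_univ b)
          · exact Finset.single_le_sum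
              (f := fun b : Fin B => ((k b + 2).descFactorial 2 : ℝ) * (16 + R) ^ (k b) * R ^ 2)
              (fun _ _ => by positivity) (Finset.mem_univ b)
          · exact (hbdd.norm_blockOps_le hd hm1 ht (by norm_num) hop b).trans
              (Finset.single_le_sum
                (f := fun b : Fin B => d b.castSucc * (d b.succ * t * (16 : ℝ) ^ (k b + 1)))
                (fun _ _ => by positivity) (Finset.mem_univ b))
          · gcongr
            linarith
      _ ≤ ENNReal.ofReal (Real.exp (-(c * m))) + ENNReal.ofReal (δ / 2) :=
          (measure_union_le _ _).trans (add_le_add (hreg m hmm₀ x) (hout m))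
      _ ≤ ENNReal.ofReal (δ / 2) + ENNReal.ofReal (δ / 2) := by
          gcongr
          simpa using hm₁ m ((le_max_right _ _).trans hm)
      _ = ENNReal.ofReal δ := by
          rw [← ENNReal.ofReal_add (half_pos hδ).le (half_pos hδ).le, add_halves]
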